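/- Let $M$ be a smooth manifold and let $X$ be a smooth complete vector field on $M$ with periodic flow: there is a smooth positive function $T:M\to\mathbb{R}$ with $\operatorname{Fl}_X^{t+T(m)}(m)=\operatorname{Fl}_X^{t}(m)$ for all $m\in M$, $t\in\mathbb{R}$. Put $\omega=2\pi/T$ and $\Upsilon=\frac1\omega X$, the infinitesimal generator of the induced $\mathbb{S}^1$-action, whose flow $\operatorname{Fl}_\Upsilon^t$ is $2\pi$-periodic. For a $k$-form $\xi$ on $M$ let $$\langle\xi\rangle=\frac1{2\pi}\int_0^{2\pi}(\operatorname{Fl}_\Upsilon^t)^*\xi\,dt,\qquad \mathcal S(\xi)=\frac1{2\pi}\int_0^{2\pi}(t-\pi)(\operatorname{Fl}_\Upsilon^t)^*\xi\,dt,$$ and call $\xi$ $\mathbb{S}^1$-invariant if $(\operatorname{Fl}_\Upsilon^t)^*\xi=\xi$ for all $t\in\mathbb{R}$. Let $\mathcal L_X$ be the Lie derivative, $\mathcal L_X\xi=\frac{d}{dt}\big|_{t=0}(\operatorname{Fl}_X^t)^*\xi$, and $\mathbf i_X$ the interior product (zero on $0$-forms). **Theorem 3.4.** Let $k\ge 0$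 and let $\eta$ be a smooth $k$-form on $M$. Then smooth $k$-forms $\theta$ and $\bar\eta$ on $M$ satisfy $$\mathcal L_X\theta=\eta-\bar\eta\qquad\text{and}\qquad \bar\eta\ \text{is}\ \mathbb{S}^1\text{-invariant}$$ if and only if there is a smooth $\mathbb{S}^1$-invariant $k$-form $\mu$ on $M$ with $$\bar\eta=\langle\eta\rangle-\frac1\omega\,d\omega\wedge\mathbf i_X\mu,\qquad \theta=\frac1\omega\mathcal S(\eta)-\frac1{\omega^3}\,d\omega\wedge\mathcal S^2(\mathbf i_X\eta)+\mu .$$ Moreover, for every smooth $\mathbb{S}^1$-invariant $k$-form $\mu$ the forms $\theta$ and $\bar\eta$ given by these formulas are smooth. -/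

import Mathlib

open scoped Manifold ContDiff Bundle

noncomputable section

namespace PeriodicFlow

section Basic

variable (E : Type*) [NormedAddCommGroup E] [NormedSpace ℝ E]
  (M : Type*) [TopologicalSpace M] [ChartedSpace E M]

/-- Vector fields on `M` (no regularity yet). -/
abbrev VField : Type _ := (x : M) → TangentSpace 𝓘(ℝ, E) x

/-- Fields of covectors on `M` (no regularity yet). -/
abbrev CovField : Type _ := (x : M) → (TangentSpace 𝓘(ℝ, E) x →L[ℝ] ℝ)

/-- Differential forms of degree `k` on `M` (no regularity yet): a field of alternating
`k`-linear forms on the tangent spaces. -/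
abbrev DForm (k : ℕ) : Type _ := (x : M) → (TangentSpace 𝓘(ℝ, E) x [⋀^Fin k]→L[ℝ] ℝ)

end Basic

variable {E : Type*} [NormedAddCommGroup E] [NormedSpace ℝ E]
  {M : Type*} [TopologicalSpace M] [ChartedSpace E M]

/-- The vector field `X` is a smooth section of the tangent bundle. -/
def SmoothVField [IsManifold 𝓘(ℝ, E) ∞ M] (X : VField E M) : Prop :=
  ContMDiff 𝓘(ℝ, E) 𝓘(ℝ, E).tangent ∞ (fun x => (⟨x, X x⟩ : TangentBundle 𝓘(ℝ, E) M))

/-- The form `θ` is a smooth section of the bundle of alternating `k`-linear forms on the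
tangent bundle, i.e. of `Λᵏ T*M`. -/
def SmoothForm [IsManifold 𝓘(ℝ, E) ∞ M] {k : ℕ} (θ : DForm E M k) : Prop :=
  ContMDiff 𝓘(ℝ, E) (𝓘(ℝ, E).prod 𝓘(ℝ, E [⋀^Fin k]→L[ℝ] ℝ)) ∞
    (fun x => (⟨x, θ x⟩ : Bundle.TotalSpace (E [⋀^Fin k]→L[ℝ] ℝ)
      (fun y : M => TangentSpace 𝓘(ℝ, E) y [⋀^Fin k]→L[ℝ] Bundle.Trivial M ℝ y)))

/-- The vector field `X` is complete: each point is the initial point of an integral curve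
defined on all of `ℝ`. -/
def CompleteVField (X : VField E M) : Prop :=
  ∀ x : M, ∃ γ : ℝ → M, γ 0 = x ∧ IsMIntegralCurve (I := 𝓘(ℝ, E)) γ X

open Classical in
/-- The flow `Fl_X^t` of a complete vector field `X`: `t ↦ flow X t x` is the integral curve of `X`
starting at `x` (unique when `X` is smooth and `M` is Hausdorff). Points through which there is
no complete integral curve, absent when `X` is complete, are left fixed. -/
def flow (X : VField E M) (t : ℝ) (x : M) : M :=
  if h : ∃ γ : ℝ → M, γ 0 = x ∧ IsMIntegralCurve (I := 𝓘(ℝ, E)) γ X then h.choose t else x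

/-- The pullback `f^* θ` of a form under a map `f : M → M`. -/
def pullback (f : M → M) {k : ℕ} (θ : DForm E M k) : DForm E M k :=
  fun x => (θ (f x)).compContinuousLinearMap (mfderiv 𝓘(ℝ, E) 𝓘(ℝ, E) f x)

/-- `ζ` is the Lie derivative `ℒ_X θ` of `θ` along the complete vector field `X`, that is
`d/dt (Fl_X^t)^* θ = ζ` at `t = 0`. The derivative is taken in the finite-dimensional vector space of
alternating forms on the tangent space at each point. -/
def HasLieDerivative (X : VField E M) {k : ℕ} (θ ζ : DForm E M k) : Prop :=
  ∀ x : M, HasDerivAt (fun t : ℝ => pullback (flow X t) θ x) (ζ x) 0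

/-- The integral `∫₀^{2π} c(t) (Fl_Y^t)^* θ dt`, taken at each point `x` in the vector space of
alternating forms on the tangent space at `x` (which is the model space `E`). -/
def flowIntegral (Y : VField E M) (c : ℝ → ℝ) {k : ℕ} (θ : DForm E M k) : DForm E M k :=
  fun x => (∫ t in (0 : ℝ)..(2 * Real.pi),
    c t • (pullback (flow Y t) θ x : E [⋀^Fin k]→L[ℝ] ℝ) : E [⋀^Fin k]→L[ℝ] ℝ)

/-- The average `⟨θ⟩ = (1/2π) ∫₀^{2π} (Fl_Y^t)^* θ dt` of a form with respect to the circle action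
with infinitesimal generator `Y`. -/
def average (Y : VField E M) {k : ℕ} (θ : DForm E M k) : DForm E M k :=
  (1 / (2 * Real.pi)) • flowIntegral Y (fun _ => 1) θ

/-- The operator `𝒮(θ) = (1/2π) ∫₀^{2π} (t - π) (Fl_Y^t)^* θ dt` for the circle action
with infinitesimal generator `Y`. -/
def opS (Y : VField E M) {k : ℕ} (θ : DForm E M k) : DForm E M k :=
  (1 / (2 * Real.pi)) • flowIntegral Y (fun t => t - Real.pi) θ

/-- Invariance of a form under the circle action with infinitesimal generator `Y`. -/
def InvariantForm (Y : VField E M) {k : ℕ} (θ : DForm E M k) : Prop :=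
  ∀ t : ℝ, pullback (flow Y t) θ = θ

/-- The differential `df` of a function. -/
def differential (f : M → ℝ) : CovField E M :=
  fun x => mfderiv 𝓘(ℝ, E) 𝓘(ℝ, ℝ) f x

/-- The interior product, `(i_X θ)(v₁, …, v_{k-1}) = θ(X, v₁, …, v_{k-1})`.
The interior product of a form of degree `0` is zero. -/
def interiorProd (X : VField E M) : {k : ℕ} → DForm E M k → DForm E M (k - 1)
  | 0, _ => 0
  | k + 1, θ => fun x =>
      ContinuousAlternatingMap.curryLeft (𝕜 := ℝ) (E := E) (F := ℝ) (n := k) (θ x) (X x)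

/-- The exterior product of a field of covectors `α` with a form `β` of degree `k - 1`,
`(α ∧ β)(v₁, …, v_k) = ∑ᵢ (-1)^{i+1} α(vᵢ) β(v₁, …, v̂ᵢ, …, v_k)`.
For `k = 0` there are no nonzero forms of degree `k - 1`, and the product is the zero form. -/
def covWedge (α : CovField E M) : {k : ℕ} → DForm E M (k - 1) → DForm E M k
  | 0, _ => 0
  | k + 1, β => fun x =>
      ContinuousAlternatingMap.alternatizeUncurryFin (𝕜 := ℝ) (E := E) (F := ℝ) (n := k)
        (ContinuousLinearMap.smulRight (M₁ := E) (M₂ := E [⋀^Fin k]→L[ℝ] ℝ) (α x) (β x))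

/-- The frequency function `ω = 2π / T` of a period function `T`. -/
def frequency (T : M → ℝ) : M → ℝ := fun x => 2 * Real.pi / T x

/-- The infinitesimal generator `Υ = (1/ω) X` of the circle action induced by a vector field `X`
whose flow is periodic with period function `T`. -/
def circleGenerator (X : VField E M) (T : M → ℝ) : VField E M :=
  fun x => (1 / frequency T x) • X x

end PeriodicFlow

end

open PeriodicFlow

open scoped Topology

universe u

namespace ContinuousMap

variable {K : Type*} [TopologicalSpace K] [CompactSpace K]

set_option synthInstance.maxHeartbeats 200000 in
/-- Pointwise application of a continuous family of continuous linear maps. -/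
noncomputable def clmApply (K : Type*) [TopologicalSpace K] [CompactSpace K] (E F : Type*)
    [NormedAddCommGroup E] [NormedSpace ℝ E] [NormedAddCommGroup F] [NormedSpace ℝ F] :
    C(K, E →L[ℝ] F) →L[ℝ] C(K, E) →L[ℝ] C(K, F) :=
  LinearMap.mkContinuous₂
    (LinearMap.mk₂ ℝ (fun (A : C(K, E →L[ℝ] F)) (h : C(K, E)) =>
        (⟨fun t => A t (h t), by fun_prop⟩ : C(K, F)))
      (fun _ _ _ => by ext; simp) (fun _ _ _ => by ext; simp)
      (fun _ _ _ => by ext; simp) (fun _ _ _ => by ext; simp)) 1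
    (fun A h => by
      rw [one_mul, ContinuousMap.norm_le _ (by positivity)]
      intro t
      exact (A t).le_of_opNorm_le_of_le (A.norm_coe_le_norm t) (h.norm_coe_le_norm t))

set_option synthInstance.maxHeartbeats 200000 in
/-- The superposition operator of a `C¹` map is differentiable. -/
theorem hasFDerivAt_comp_left {E F : Type*} [NormedAddCommGroup E] [NormedSpace ℝ E]
    [NormedAddCommGroup F] [NormedSpace ℝ F] {f : E → F} {f' : E → E →L[ℝ] F}
    (hf : ∀ x, HasFDerivAt f (f' x) x) (hc : Continuous f) (hc' : Continuous f') (γ : C(K, E)) :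
    HasFDerivAt (fun γ : C(K, E) => (⟨f, hc⟩ : C(E, F)).comp γ)
      (clmApply K E F ((⟨f', hc'⟩ : C(E, E →L[ℝ] F)).comp γ)) γ := by
  rw [hasFDerivAt_iff_isLittleO_nhds_zero, Asymptotics.isLittleO_iff]
  intro ε hε
  have hK : IsCompact (Set.range γ) := isCompact_range γ.continuous
  obtain ⟨δ, hδ, H⟩ : ∃ δ > 0, ∀ y ∈ Set.range γ, ∀ z, dist y z < δ → dist (f' y) (f' z) < ε := by
    have := hK.uniformContinuousAt_of_continuousAt f' (fun x _ => hc'.continuousAt)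
      (Metric.dist_mem_uniformity hε)
    obtain ⟨δ, hδ, h⟩ := Metric.mem_uniformity_dist.1 this
    exact ⟨δ, hδ, fun y hy z hz => h hz hy⟩
  filter_upwards [Metric.ball_mem_nhds (0 : C(K, E)) hδ] with h hh
  rw [ContinuousMap.norm_le _ (by positivity)]
  intro t
  have hh' : ‖h t‖ < δ := (h.norm_coe_le_norm t).trans_lt (by simpa using hh)
  have key := (convex_ball (γ t) δ).norm_image_sub_le_of_norm_hasFDerivWithin_le' (f := f) (f' := f')
    (φ := f' (γ t)) (C := ε) (x := γ t) (y := γ t + h t)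
    (fun x _ => (hf x).hasFDerivWithinAt) (fun x hx => by
      have := H (γ t) ⟨t, rfl⟩ x (by rw [dist_comm]; exact hx)
      rw [dist_comm, dist_eq_norm] at this
      exact this.le) (Metric.mem_ball_self hδ) (by simpa [Metric.mem_ball, dist_eq_norm] using hh')
  simp only [add_sub_cancel_left] at key
  exact key.trans (mul_le_mul_of_nonneg_left (h.norm_coe_le_norm t) hε.le)

set_option synthInstance.maxHeartbeats 200000 in
theorem contDiff_comp_left_nat {E : Type u} [NormedAddCommGroup E] [NormedSpace ℝ E] (n : ℕ) :
    ∀ {F : Type u} [NormedAddCommGroup F] [NormedSpace ℝ F] {f : E → F} (_ : ContDiff ℝ n f)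
      (hc : Continuous f), ContDiff ℝ n (fun γ : C(K, E) => (⟨f, hc⟩ : C(E, F)).comp γ) := by
  induction n with
  | zero =>
    intro F _ _ f _ hc
    simp only [Nat.cast_zero, contDiff_zero]
    exact ContinuousMap.continuous_postcomp _
  | succ n ih =>
    intro F _ _ f hf hc
    have hf1 : ContDiff ℝ n (fderiv ℝ f) := hf.fderiv_right (by simp)
    have hd : Differentiable ℝ f := hf.differentiable (by simp)
    push_cast
    rw [contDiff_succ_iff_hasFDerivAt]
    refine ⟨fun γ => clmApply K E F ((⟨fderiv ℝ f, hf1.continuous⟩ : C(E, E →L[ℝ] F)).comp γ), ?_,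
      fun γ => hasFDerivAt_comp_left (fun x => (hd x).hasFDerivAt) hc hf1.continuous γ⟩
    exact (clmApply K E F).contDiff.comp (ih hf1 hf1.continuous)

/-- The superposition operator of a smooth map is smooth. -/
theorem contDiff_comp_left {E F : Type u} [NormedAddCommGroup E] [NormedSpace ℝ E]
    [NormedAddCommGroup F] [NormedSpace ℝ F] {f : E → F} (hf : ContDiff ℝ ∞ f) :
    ContDiff ℝ ∞ (fun γ : C(K, E) => (⟨f, hf.continuous⟩ : C(E, F)).comp γ) :=
  contDiff_infty.2 fun n => contDiff_comp_left_nat n (contDiff_infty.1 hf n) hf.continuous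

end ContinuousMap

/-- A function that is smooth on an open neighbourhood of a compact set agrees near this set with
a globally smooth function. -/
theorem ContDiffOn.exists_contDiff_eventuallyEq {E F : Type*} [NormedAddCommGroup E]
    [NormedSpace ℝ E] [FiniteDimensional ℝ E] [NormedAddCommGroup F] [NormedSpace ℝ F] {f : E → F}
    {U K : Set E} (hf : ContDiffOn ℝ ∞ f U) (hU : IsOpen U) (hK : IsCompact K) (hKU : K ⊆ U) :
    ∃ g : E → F, ContDiff ℝ ∞ g ∧ ∀ᶠ x in 𝓝ˢ K, g x = f x := by
  obtain ⟨L, hL, hKL, hLU⟩ := exists_compact_between hK hU hKU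
  obtain ⟨χ, h1, h0, -⟩ := exists_contMDiffMap_one_nhds_of_subset_interior (n := ⊤) 𝓘(ℝ, E)
    hK.isClosed hKL
  refine ⟨fun x => χ x • f x, contDiff_iff_contDiffAt.2 fun x => ?_, ?_⟩
  · by_cases hx : x ∈ U
    · exact χ.contMDiff.contDiff.contDiffAt.smul (hf.contDiffAt (hU.mem_nhds hx))
    · refine (contDiffAt_const (c := (0 : F))).congr_of_eventuallyEq ?_
      filter_upwards [hL.isClosed.isOpen_compl.mem_nhds fun h => hx (hLU h)] with y hy
      simp [h0 y hy]
  · filter_upwards [h1] with x hx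
    simp [hx]

namespace ContinuousMap

variable {E : Type*} [NormedAddCommGroup E] [NormedSpace ℝ E]

theorem norm_intervalIntegral_projIcc_le {a b : ℝ} (h : a ≤ b) (γ : C(Set.Icc a b, E))
    (s t : Set.Icc a b) : ‖∫ τ in (s : ℝ)..t, γ (Set.projIcc a b h τ)‖ ≤ (b - a) * ‖γ‖ := by
  have := intervalIntegral.norm_integral_le_of_norm_le_const (a := (s : ℝ)) (b := t) (C := ‖γ‖)
    (f := fun τ => γ (Set.projIcc a b h τ)) fun τ _ => γ.norm_coe_le_norm _
  refine this.trans ?_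
  rw [mul_comm]
  gcongr
  rw [abs_le]
  constructor <;> linarith [s.2.1, s.2.2, t.2.1, t.2.2]

/-- The primitive vanishing at `t₀` of a continuous function on a compact interval. -/
noncomputable def primitive {a b : ℝ} (h : a ≤ b) (t₀ : Set.Icc a b) :
    C(Set.Icc a b, E) →L[ℝ] C(Set.Icc a b, E) :=
  LinearMap.mkContinuous
    { toFun := fun γ => ⟨fun t => ∫ τ in (t₀ : ℝ)..t, γ (Set.projIcc a b h τ), by
        have hc : Continuous fun τ => γ (Set.projIcc a b h τ) :=
          γ.continuous.comp continuous_projIcc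
        exact (intervalIntegral.continuous_primitive (fun _ _ => hc.intervalIntegrable _ _)
          _).comp continuous_subtype_val⟩
      map_add' := fun γ₁ γ₂ => by
        ext t
        exact intervalIntegral.integral_add
          ((γ₁.continuous.comp continuous_projIcc).intervalIntegrable _ _)
          ((γ₂.continuous.comp continuous_projIcc).intervalIntegrable _ _)
      map_smul' := fun c γ => by
        ext t
        exact intervalIntegral.integral_smul c _ }
    (b - a) fun γ => by
      rw [ContinuousMap.norm_le _ (mul_nonneg (by linarith) (norm_nonneg _))]
      exact fun t => norm_intervalIntegral_projIcc_le h γ t₀ t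

end ContinuousMap

/-- Smooth dependence of an integral on parameters. -/
theorem ContDiffOn.contDiffAt_intervalIntegral {E V : Type u} [NormedAddCommGroup E]
    [NormedSpace ℝ E] [FiniteDimensional ℝ E] [NormedAddCommGroup V] [NormedSpace ℝ V]
    {F : ℝ × E → V} {U : Set E} (hU : IsOpen U) (hF : ContDiffOn ℝ ∞ F (Set.univ ×ˢ U)) {a b : ℝ}
    (hab : a ≤ b) {x₀ : E} (hx₀ : x₀ ∈ U) :
    ContDiffAt ℝ ∞ (fun x => ∫ t in a..b, F (t, x)) x₀ := by
  obtain ⟨g, hg, hgF⟩ := hF.exists_contDiff_eventuallyEq (isOpen_univ.prod hU)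
    (K := Set.Icc a b ×ˢ {x₀}) (isCompact_Icc.prod isCompact_singleton)
    (Set.prod_mono (Set.subset_univ _) (by simpa using hx₀))
  rw [Filter.Eventually, isCompact_Icc.nhdsSet_prod_eq isCompact_singleton, nhdsSet_singleton] at hgF
  have hgF' : ∀ᶠ x in 𝓝 x₀, ∀ t ∈ Set.Icc a b, g (t, x) = F (t, x) := by
    obtain ⟨A, hA, B, hB, hAB⟩ := Filter.mem_prod_iff.1 hgF
    filter_upwards [hB] with x hx t ht
    exact hAB ⟨subset_of_mem_nhdsSet hA ht, hx⟩
  let c : E →L[ℝ] C(Set.Icc a b, ℝ × E) := LinearMap.mkContinuous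
    { toFun := fun x => ContinuousMap.const _ (0, x)
      map_add' := fun x y => by ext <;> simp
      map_smul' := fun r x => by ext <;> simp } 1 fun x => by
        rw [one_mul, ContinuousMap.norm_le _ (norm_nonneg _)]
        intro t
        simp
  let ι : C(Set.Icc a b, ℝ × E) := ⟨fun t => (t, 0), by fun_prop⟩
  have h1 : ContDiff ℝ ∞ fun x => ι + c x := contDiff_const.add c.contDiff
  have h2 := (ContinuousMap.contDiff_comp_left (K := Set.Icc a b) hg).comp h1
  let b' : Set.Icc a b := ⟨b, hab, le_rfl⟩
  let L : C(Set.Icc a b, V) →L[ℝ] V := (ContinuousMap.evalCLM ℝ b').comp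
    (ContinuousMap.primitive hab ⟨a, le_rfl, hab⟩)
  have h3 := (L.contDiff.comp h2).contDiffAt (x := x₀)
  refine h3.congr_of_eventuallyEq ?_
  filter_upwards [hgF'] with x hx
  change _ = ∫ t in a..b, g ((ι + c x) (Set.projIcc a b hab t))
  refine intervalIntegral.integral_congr fun t ht => ?_
  rw [Set.uIcc_of_le hab] at ht
  rw [Set.projIcc_of_mem hab ht, ← hx t ht]
  simp [ι, c]

/-- Rescaled local solutions of the equation `γ' = s • f γ`, `γ 0 = x`, depend smoothly on `(s, x)`,
as elements of the space of continuous curves. -/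
theorem ContDiff.exists_contDiffAt_integralCurve {E : Type u} [NormedAddCommGroup E]
    [NormedSpace ℝ E] [CompleteSpace E] {f : E → E} (hf : ContDiff ℝ ∞ f) (x₀ : E) {a b : ℝ}
    (hab : a ≤ b) (t₀ : Set.Icc a b) :
    ∃ Γ : ℝ × E → C(Set.Icc a b, E), ContDiffAt ℝ ∞ Γ (0, x₀) ∧
      Γ (0, x₀) = ContinuousMap.const _ x₀ ∧
      ∀ᶠ p in 𝓝 ((0 : ℝ), x₀), ∀ t : Set.Icc a b,
        Γ p t = p.2 + p.1 • ∫ τ in (t₀ : ℝ)..t, f (Γ p (Set.projIcc a b hab τ)) := by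
  let C := C(Set.Icc a b, E)
  let N : C → C := fun γ => (⟨f, hf.continuous⟩ : C(E, E)).comp γ
  have hN : ContDiff ℝ ∞ N := ContinuousMap.contDiff_comp_left hf
  let J : C →L[ℝ] C := ContinuousMap.primitive hab t₀
  let c : E →L[ℝ] C := LinearMap.mkContinuous
    { toFun := fun x => ContinuousMap.const _ x
      map_add' := fun x y => by ext; rfl
      map_smul' := fun r x => by ext; rfl } 1 fun x => by
        rw [one_mul, ContinuousMap.norm_le _ (norm_nonneg _)]
        intro t
        simp
  let Ψ : (ℝ × E) × C → (ℝ × E) × C := fun q => (q.1, q.2 - c q.1.2 - q.1.1 • J (N q.2))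
  have hΨ : ContDiff ℝ ∞ Ψ := by
    have : ContDiff ℝ ∞ fun q : (ℝ × E) × C => J (N q.2) :=
      J.contDiff.comp (hN.comp contDiff_snd)
    have h2 : ContDiff ℝ ∞ fun q : (ℝ × E) × C => c q.1.2 :=
      c.contDiff.comp (contDiff_snd.comp contDiff_fst)
    exact contDiff_fst.prodMk ((contDiff_snd.sub h2).sub
      ((contDiff_fst.comp contDiff_fst).smul this))
  let B : (ℝ × E) →L[ℝ] C := -(c.comp (ContinuousLinearMap.snd ℝ ℝ E)) -
    (ContinuousLinearMap.fst ℝ ℝ E).smulRight (J (N (c x₀)))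
  let e : ((ℝ × E) × C) ≃L[ℝ] ((ℝ × E) × C) :=
    (ContinuousLinearEquiv.refl ℝ (ℝ × E)).skewProd (ContinuousLinearEquiv.refl ℝ C) B
  let q₀ : (ℝ × E) × C := ((0, x₀), c x₀)
  have hd : HasFDerivAt Ψ (e : ((ℝ × E) × C) →L[ℝ] ((ℝ × E) × C)) q₀ := by
    have hJN : HasFDerivAt (fun q : (ℝ × E) × C => J (N q.2))
        (fderiv ℝ (fun q : (ℝ × E) × C => J (N q.2)) q₀) q₀ :=
      ((J.contDiff.comp (hN.comp contDiff_snd)).differentiable (by simp) q₀).hasFDerivAt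
    have hs : HasFDerivAt (fun q : (ℝ × E) × C => q.1.1)
        ((ContinuousLinearMap.fst ℝ ℝ E).comp (ContinuousLinearMap.fst ℝ (ℝ × E) C)) q₀ :=
      ContinuousLinearMap.hasFDerivAt
        ((ContinuousLinearMap.fst ℝ ℝ E).comp (ContinuousLinearMap.fst ℝ (ℝ × E) C))
    have hc : HasFDerivAt (fun q : (ℝ × E) × C => c q.1.2)
        ((c.comp (ContinuousLinearMap.snd ℝ ℝ E)).comp (ContinuousLinearMap.fst ℝ (ℝ × E) C)) q₀ :=
      ContinuousLinearMap.hasFDerivAt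
        ((c.comp (ContinuousLinearMap.snd ℝ ℝ E)).comp (ContinuousLinearMap.fst ℝ (ℝ × E) C))
    have := hasFDerivAt_fst.prodMk ((hasFDerivAt_snd.sub hc).sub (hs.smul hJN)) (x := q₀)
    convert! this using 1
    refine ContinuousLinearMap.ext fun v => ?_
    refine Prod.ext rfl ?_
    simp [e, B, q₀]
    abel
  have hne : (∞ : WithTop ℕ∞) ≠ 0 := by simp
  let G := hΨ.contDiffAt.localInverse hd hne
  have hq₀ : Ψ q₀ = ((0, x₀), 0) := by simp [Ψ, q₀]
  have hG : ContDiffAt ℝ ∞ G ((0, x₀), 0) := hq₀ ▸ hΨ.contDiffAt.to_localInverse hd hne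
  have hG₀ : G ((0, x₀), 0) = q₀ := hq₀ ▸ hΨ.contDiffAt.localInverse_apply_image hd hne
  have hinv : ∀ᶠ y in 𝓝 (((0 : ℝ), x₀), (0 : C)), Ψ (G y) = y := by
    have := (hΨ.contDiffAt.hasStrictFDerivAt' hd hne).eventually_right_inverse
    rw [hq₀] at this
    exact this
  have hi : ContDiff ℝ ∞ fun p : ℝ × E => (p, (0 : C)) := contDiff_id.prodMk contDiff_const
  refine ⟨fun p => (G (p, 0)).2, ?_, ?_, ?_⟩
  · exact (ContDiffAt.comp (0, x₀) hG hi.contDiffAt).snd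
  · simp only [hG₀]; rfl
  · filter_upwards [hi.continuous.continuousAt.eventually hinv] with p hp t
    have h1 : (G (p, 0)).1 = p := congrArg Prod.fst hp
    have h2 : (G (p, 0)).2 - c (G (p, 0)).1.2 - (G (p, 0)).1.1 • J (N (G (p, 0)).2) = 0 :=
      congrArg Prod.snd hp
    rw [h1, sub_sub, sub_eq_zero] at h2
    exact congrArg (fun γ : C => γ t) h2

namespace PeriodicFlow

variable {E : Type u} [NormedAddCommGroup E] [NormedSpace ℝ E]
  {M : Type*} [TopologicalSpace M] [ChartedSpace E M]

theorem CompleteVField.flow_zero {X : VField E M} (hc : CompleteVField X) (x : M) :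
    flow X 0 x = x := by
  rw [flow, dif_pos (hc x)]
  exact (hc x).choose_spec.1

theorem CompleteVField.isMIntegralCurve_flow {X : VField E M} (hc : CompleteVField X) (x : M) :
    IsMIntegralCurve (I := 𝓘(ℝ, E)) (fun t => flow X t x) X := by
  have : (fun t => flow X t x) = (hc x).choose := by
    ext t
    rw [flow, dif_pos (hc x)]
  rw [this]
  exact (hc x).choose_spec.2

variable [IsManifold 𝓘(ℝ, E) ∞ M]

instance : IsManifold 𝓘(ℝ, E) (∞ + 1) M := inferInstanceAs (IsManifold 𝓘(ℝ, E) ∞ M)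

/-- The representation of a vector field in the chart at `x₀`. -/
noncomputable def chartField (X : VField E M) (x₀ : M) (y : E) : E :=
  tangentCoordChange 𝓘(ℝ, E) ((extChartAt 𝓘(ℝ, E) x₀).symm y) x₀ ((extChartAt 𝓘(ℝ, E) x₀).symm y)
    (X ((extChartAt 𝓘(ℝ, E) x₀).symm y))

theorem SmoothVField.contDiffOn_chartField {X : VField E M} (hX : SmoothVField X) (x₀ : M) :
    ContDiffOn ℝ ∞ (chartField X x₀) (extChartAt 𝓘(ℝ, E) x₀).target := by
  rw [← contMDiffOn_iff_contDiffOn]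
  intro y hy
  have hp : (extChartAt 𝓘(ℝ, E) x₀).symm y ∈ (trivializationAt E (TangentSpace 𝓘(ℝ, E)) x₀).baseSet := by
    have := (extChartAt 𝓘(ℝ, E) x₀).map_target hy
    rwa [extChartAt_source] at this
  have h1 := ((trivializationAt E (TangentSpace 𝓘(ℝ, E)) x₀).contMDiffAt_section_iff hp).1
    (hX ((extChartAt 𝓘(ℝ, E) x₀).symm y))
  exact (h1.comp_contMDiffWithinAt y (contMDiffOn_extChartAt_symm x₀ y hy)).congr (fun _ _ => rfl) rfl

/-- An integral curve in a chart yields an integral curve on the manifold. -/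
theorem hasMFDerivAt_extChartAt_symm_comp {X : VField E M} {x₀ : M} {δ : ℝ → E} {s t : ℝ}
    (hδ : HasDerivAt δ (s • chartField X x₀ (δ t)) t)
    (ht : δ t ∈ (extChartAt 𝓘(ℝ, E) x₀).target) :
    HasMFDerivAt 𝓘(ℝ, ℝ) 𝓘(ℝ, E) (fun τ => (extChartAt 𝓘(ℝ, E) x₀).symm (δ τ)) t
      ((1 : ℝ →L[ℝ] ℝ).smulRight ((s • X) ((extChartAt 𝓘(ℝ, E) x₀).symm (δ t)))) := by
  have hd : HasMFDerivAt 𝓘(ℝ, ℝ) 𝓘(ℝ, E) δ t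
      ((1 : ℝ →L[ℝ] ℝ).smulRight (s • chartField X x₀ (δ t))) := by
    convert! hδ.hasFDerivAt.hasMFDerivAt using 1
  set p := (extChartAt 𝓘(ℝ, E) x₀).symm (δ t) with hp
  have hs : p ∈ (extChartAt 𝓘(ℝ, E) x₀).source := (extChartAt 𝓘(ℝ, E) x₀).map_target ht
  have hpp := mem_extChartAt_source (I := 𝓘(ℝ, E)) p
  have hD (D : E →L[ℝ] E) (hD : D = tangentCoordChange 𝓘(ℝ, E) x₀ p p) :
      HasMFDerivAt 𝓘(ℝ, E) 𝓘(ℝ, E) (extChartAt 𝓘(ℝ, E) x₀).symm (δ t) D := by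
    subst hD
    refine ⟨(continuousAt_extChartAt_symm'' ht), ?_⟩
    have := hasFDerivWithinAt_tangentCoordChange (I := 𝓘(ℝ, E)) (x := x₀) (y := p) (z := p) ⟨hs, hpp⟩
    rw [(extChartAt 𝓘(ℝ, E) x₀).right_inv ht] at this
    simp [Function.comp_def, hp] at this
    simp [writtenInExtChartAt, Function.comp_def, hp, chartAt_self_eq]
    exact this.hasFDerivWithinAt
  have key (v : E) :
      tangentCoordChange 𝓘(ℝ, E) x₀ p p (tangentCoordChange 𝓘(ℝ, E) p x₀ p v) = v := by
    rw [tangentCoordChange_comp ⟨⟨hpp, hs⟩, hpp⟩, tangentCoordChange_self hpp]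
  refine ((hD _ rfl).comp t hd).congr_mfderiv (ContinuousLinearMap.ext fun (r : ℝ) => ?_)
  change tangentCoordChange 𝓘(ℝ, E) x₀ p p (r • s • tangentCoordChange 𝓘(ℝ, E) p x₀ p (X p)) =
    (r • s • (X p : E) : E)
  rw [map_smul, map_smul]
  exact congrArg (fun w : E => r • s • w) (key (X p))

variable [T2Space M]

section
variable [FiniteDimensional ℝ E]

theorem SmoothVField.flow_eq {X : VField E M} (hX : SmoothVField X) (hc : CompleteVField X)
    {γ : ℝ → M} (hγ : IsMIntegralCurve (I := 𝓘(ℝ, E)) γ X) (t : ℝ) : flow X t (γ 0) = γ t := by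
  have := FiniteDimensional.complete ℝ E
  have := isMIntegralCurve_Ioo_eq_of_contMDiff_boundaryless (t₀ := 0) (hX.of_le (by simp))
    (hc.isMIntegralCurve_flow (γ 0)) hγ (hc.flow_zero _)
  exact congrFun this t

theorem SmoothVField.flow_add {X : VField E M} (hX : SmoothVField X) (hc : CompleteVField X)
    (s t : ℝ) (x : M) : flow X (s + t) x = flow X s (flow X t x) := by
  have := hX.flow_eq hc ((hc.isMIntegralCurve_flow x).comp_add t) s
  simpa using this.symm

theorem SmoothVField.eventually_contMDiffAt_flow {X : VField E M} (hX : SmoothVField X)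
    (hc : CompleteVField X) (n : ℕ) (x₀ : M) :
    ∀ᶠ p in 𝓝 ((0 : ℝ), x₀), ContMDiffAt (𝓘(ℝ, ℝ).prod 𝓘(ℝ, E)) 𝓘(ℝ, E) n
      (fun p : ℝ × M => flow X p.1 p.2) p := by
  have hcomplete := FiniteDimensional.complete ℝ E
  set e := extChartAt 𝓘(ℝ, E) x₀ with he
  have het : IsOpen e.target := isOpen_extChartAt_target x₀
  have hy₀ : e x₀ ∈ e.target := mem_extChartAt_target x₀
  obtain ⟨g, hg, hgf⟩ := (hX.contDiffOn_chartField x₀).exists_contDiff_eventuallyEq het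
    (K := {e x₀}) isCompact_singleton (Set.singleton_subset_iff.2 hy₀)
  rw [nhdsSet_singleton] at hgf
  obtain ⟨W, hW, hWo, hWy⟩ := eventually_nhds_iff.1 (hgf.and (het.mem_nhds hy₀))
  have hab : (-1 : ℝ) ≤ 2 := by norm_num
  let t₀ : Set.Icc (-1 : ℝ) 2 := ⟨0, by norm_num, by norm_num⟩
  let t₁ : Set.Icc (-1 : ℝ) 2 := ⟨1, by norm_num, by norm_num⟩
  obtain ⟨Γ, hΓ, hΓ₀, hΓi⟩ := hg.exists_contDiffAt_integralCurve (e x₀) hab t₀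
  have hΓW : ∀ᶠ p in 𝓝 ((0 : ℝ), e x₀), ∀ t, Γ p t ∈ W := by
    have ho : IsOpen {γ : C(Set.Icc (-1 : ℝ) 2, E) | Set.MapsTo γ Set.univ W} :=
      ContinuousMap.isOpen_setOfPred_mapsTo isCompact_univ hWo
    have := hΓ.continuousAt.eventually (ho.mem_nhds (by
      rw [hΓ₀]; exact fun _ _ => hWy))
    filter_upwards [this] with p hp t using hp (Set.mem_univ t)
  have hflow : ∀ᶠ p in 𝓝 ((0 : ℝ), e x₀), flow X p.1 (e.symm p.2) = e.symm (Γ p t₁) := by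
    filter_upwards [hΓi, hΓW] with p hp hpW
    obtain ⟨s, y⟩ := p
    let δ : ℝ → E := fun t => Γ (s, y) (Set.projIcc _ _ hab t)
    have hδ : ∀ t ∈ Set.Ioo (-1 : ℝ) 2, HasDerivAt δ (s • chartField X x₀ (δ t)) t := by
      intro t ht
      have hcont : Continuous fun τ => g (δ τ) :=
        hg.continuous.comp ((Γ (s, y)).continuous.comp continuous_projIcc)
      have h1 := ((intervalIntegral.integral_hasDerivAt_right (hcont.intervalIntegrable 0 t)
        (hcont.stronglyMeasurableAtFilter _ _) hcont.continuousAt).const_smul s).const_add y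
      rw [← (hW _ (hpW _)).1]
      refine h1.congr_of_eventuallyEq ?_
      filter_upwards [Ioo_mem_nhds ht.1 ht.2] with τ hτ
      have := hp (Set.projIcc _ _ hab τ)
      rw [Set.projIcc_of_mem hab ⟨hτ.1.le, hτ.2.le⟩] at this
      simpa [δ, Set.projIcc_of_mem hab ⟨hτ.1.le, hτ.2.le⟩] using this
    have hcur : IsMIntegralCurveOn (I := 𝓘(ℝ, E)) (fun t => e.symm (δ t)) (s • X)
        (Set.Ioo (-1) 2) := fun t ht =>
      (hasMFDerivAt_extChartAt_symm_comp (hδ t ht) (hW _ (hpW _)).2).hasMFDerivWithinAt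
    have hsX : SmoothVField (s • X) := by
      exact ContMDiff.const_smul_section hX
    have hfl := (hc.isMIntegralCurve_flow (e.symm y)).comp_mul s
    have h0 : δ 0 = y := by
      have := hp t₀
      simpa [δ, t₀, Set.projIcc_of_mem hab t₀.2] using this
    have := isMIntegralCurveOn_Ioo_eqOn_of_contMDiff_boundaryless (t₀ := 0) (by norm_num)
      (hsX.of_le (by simp)) (hfl.isMIntegralCurveOn _) hcur (by simp [h0, hc.flow_zero])
      (show (1 : ℝ) ∈ Set.Ioo (-1) 2 by norm_num)
    simpa [δ, t₁, Set.projIcc_of_mem hab t₁.2] using this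
  have hex : ContMDiffAt (𝓘(ℝ, ℝ).prod 𝓘(ℝ, E)) (𝓘(ℝ, ℝ).prod 𝓘(ℝ, E)) ∞
      (fun p : ℝ × M => ((p.1, e p.2) : ℝ × E)) (0, x₀) :=
    contMDiffAt_fst.prodMk (ContMDiffAt.comp (0, x₀) contMDiffAt_extChartAt contMDiffAt_snd)
  have hΓ1 : ContMDiffAt 𝓘(ℝ, ℝ × E) 𝓘(ℝ, E) ∞ (fun p => Γ p t₁) (0, e x₀) :=
    (ContDiffAt.comp (0, e x₀)
      (ContinuousMap.evalCLM ℝ t₁ : C(Set.Icc (-1 : ℝ) 2, E) →L[ℝ] E).contDiff.contDiffAt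
      hΓ).contMDiffAt
  have hsymm : ContMDiffAt 𝓘(ℝ, E) 𝓘(ℝ, E) ∞ e.symm (Γ (0, e x₀) t₁) := by
    rw [hΓ₀]
    exact (contMDiffOn_extChartAt_symm x₀).contMDiffAt (het.mem_nhds hy₀)
  rw [modelWithCornersSelf_prod, ← chartedSpaceSelf_prod] at hΓ1
  have hcomp : ContMDiffAt (𝓘(ℝ, ℝ).prod 𝓘(ℝ, E)) 𝓘(ℝ, E) ∞
      (fun p : ℝ × M => e.symm (Γ (p.1, e p.2) t₁)) (0, x₀) :=
    ContMDiffAt.comp (0, x₀) hsymm (ContMDiffAt.comp (0, x₀) hΓ1 hex)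
  have hfin : ContMDiffAt (𝓘(ℝ, ℝ).prod 𝓘(ℝ, E)) 𝓘(ℝ, E) ∞
      (fun p : ℝ × M => flow X p.1 p.2) (0, x₀) := by
    refine hcomp.congr_of_eventuallyEq ?_
    have hs : ∀ᶠ p : ℝ × M in 𝓝 (0, x₀), p.2 ∈ e.source :=
      continuousAt_snd.eventually (extChartAt_source_mem_nhds x₀)
    filter_upwards [hex.continuousAt.eventually hflow, hs] with p hp hps
    rw [← hp]
    simp only [e.left_inv hps]
  have hn : ContMDiffAt (𝓘(ℝ, ℝ).prod 𝓘(ℝ, E)) 𝓘(ℝ, E) n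
      (fun p : ℝ × M => flow X p.1 p.2) (0, x₀) := hfin.of_le (by exact_mod_cast le_top)
  exact (contMDiffAt_iff_contMDiffAt_nhds (by simp)).1 hn

/-- The flow of a smooth complete vector field is smooth, jointly in time and space. -/
theorem SmoothVField.contMDiff_flow {X : VField E M} (hX : SmoothVField X)
    (hc : CompleteVField X) :
    ContMDiff (𝓘(ℝ, ℝ).prod 𝓘(ℝ, E)) 𝓘(ℝ, E) ∞ (fun p : ℝ × M => flow X p.1 p.2) := by
  rw [contMDiff_infty]
  rintro n ⟨t, x₀⟩
  let P : ℝ × M → Prop := fun p => ContMDiffAt (𝓘(ℝ, ℝ).prod 𝓘(ℝ, E)) 𝓘(ℝ, E) n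
    (fun p : ℝ × M => flow X p.1 p.2) p
  let S : Set ℝ := {t | ∀ᶠ p in 𝓝 (t, x₀), P p}
  have hcurve : Continuous fun t => flow X t x₀ :=
    continuous_iff_continuousAt.2 fun t => (hc.isMIntegralCurve_flow x₀ t).continuousAt
  have hSo : IsOpen S := by
    rw [isOpen_iff_mem_nhds]
    intro t ht
    exact (Continuous.prodMk_left x₀).continuousAt.eventually (eventually_eventually_nhds.2 ht)
  have hSc : IsClosed S := by
    rw [← closure_subset_iff_isClosed]
    intro t ht
    obtain ⟨A, hA, B, hB, hAB⟩ := mem_nhds_prod_iff.1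
      (eventually_eventually_nhds.2 (hX.eventually_contMDiffAt_flow hc n (flow X t x₀)))
    have h1 : ∀ᶠ r in 𝓝 t, flow X r x₀ ∈ interior B :=
      hcurve.continuousAt.eventually (isOpen_interior.mem_nhds (mem_interior_iff_mem_nhds.2 hB))
    have h2 : ∀ᶠ r in 𝓝 t, t - r ∈ interior A := by
      have : ContinuousAt (fun r => t - r) t := by fun_prop
      refine this.eventually (isOpen_interior.mem_nhds ?_)
      simpa using mem_interior_iff_mem_nhds.2 hA
    obtain ⟨r, hrS, hrB, hrA⟩ := (mem_closure_iff_frequently.1 ht).and_eventually (h1.and h2) |>.exists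
    have hr : P (r, x₀) := Filter.Eventually.self_of_nhds hrS
    have hmap : ∀ᶠ p : ℝ × M in 𝓝 (t, x₀), P (r, p.2) :=
      Filter.Tendsto.eventually (f := fun p : ℝ × M => (r, p.2)) (l₂ := 𝓝 (r, x₀))
        (Continuous.tendsto (by fun_prop) (t, x₀)) hrS
    have h3 : ∀ᶠ p : ℝ × M in 𝓝 (t, x₀), p.1 - r ∈ A := by
      have : ContinuousAt (fun p : ℝ × M => p.1 - r) (t, x₀) := by fun_prop
      exact this.eventually (mem_interior_iff_mem_nhds.1 hrA)
    have hcr : ContinuousAt (fun p : ℝ × M => flow X r p.2) (t, x₀) :=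
      ContinuousAt.comp (x := (t, x₀)) (f := fun p : ℝ × M => (r, p.2))
        (g := fun p : ℝ × M => flow X p.1 p.2) hr.continuousAt (by fun_prop)
    have h4 : ∀ᶠ p : ℝ × M in 𝓝 (t, x₀), flow X r p.2 ∈ B :=
      hcr.eventually (mem_interior_iff_mem_nhds.1 hrB)
    filter_upwards [hmap, h3, h4] with p hp hpA hpB
    have h5 : P (p.1 - r, flow X r p.2) :=
      (show ∀ᶠ q in 𝓝 (p.1 - r, flow X r p.2), P q from hAB ⟨hpA, hpB⟩).self_of_nhds
    have h6 : ContMDiffAt (𝓘(ℝ, ℝ).prod 𝓘(ℝ, E)) 𝓘(ℝ, E) n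
        (fun p : ℝ × M => flow X r p.2) p :=
      ContMDiffAt.comp p (g := fun p : ℝ × M => flow X p.1 p.2) (f := fun p : ℝ × M => (r, p.2))
        hp (contMDiffAt_const.prodMk contMDiffAt_snd)
    have h7 : ContMDiffAt (𝓘(ℝ, ℝ).prod 𝓘(ℝ, E)) 𝓘(ℝ, ℝ) n
        (fun p : ℝ × M => p.1 - r) p := contMDiffAt_fst.sub contMDiffAt_const
    have h8 := ContMDiffAt.comp p (g := fun p : ℝ × M => flow X p.1 p.2)
      (f := fun p : ℝ × M => (p.1 - r, flow X r p.2)) h5 (h7.prodMk h6)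
    refine h8.congr_of_eventuallyEq (Filter.Eventually.of_forall fun q => ?_)
    simp [← hX.flow_add hc]
  have hS : S = Set.univ := IsClopen.eq_univ ⟨hSc, hSo⟩
    ⟨0, hX.eventually_contMDiffAt_flow hc n x₀⟩
  exact Filter.Eventually.self_of_nhds (show t ∈ S from hS ▸ Set.mem_univ t)

end

end PeriodicFlow

namespace ContinuousAlternatingMap

variable {E : Type*} [NormedAddCommGroup E] [NormedSpace ℝ E] {k : ℕ}

/-- The extension of an endomorphism `A` to alternating forms as a derivation,
`(A β)(v₁, …, v_k) = ∑ᵢ β(v₁, …, A vᵢ, …, v_k)`. -/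
noncomputable def derivationExt :
    (E →L[ℝ] E) →L[ℝ] (E [⋀^Fin k]→L[ℝ] ℝ) →L[ℝ] (E [⋀^Fin k]→L[ℝ] ℝ) :=
  (fderivCompContinuousLinearMapCLM ℝ (.id ℝ E)).flip

theorem derivationExt_eq (A : E →L[ℝ] E) (β : E [⋀^Fin k]→L[ℝ] ℝ) :
    derivationExt A β = β.fderivCompContinuousLinearMap (.id ℝ E) A := rfl

theorem derivationExt_apply (A : E →L[ℝ] E) (β : E [⋀^Fin k]→L[ℝ] ℝ) (v : Fin k → E) :
    derivationExt A β v = ∑ i, β (Function.update v i (A (v i))) := by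
  rw [derivationExt_eq, fderivCompContinuousLinearMap_apply]
  refine Finset.sum_congr rfl fun i _ => congrArg β (funext fun j => ?_)
  rcases eq_or_ne j i with rfl | h
  · simp
  · simp [h]

theorem derivationExt_compContinuousLinearMap {A B C : E →L[ℝ] E} (h : A ∘L B = B ∘L C)
    (β : E [⋀^Fin k]→L[ℝ] ℝ) :
    (derivationExt A β).compContinuousLinearMap B
      = derivationExt C (β.compContinuousLinearMap B) := by
  ext v
  have h' (w : E) : A (B w) = B (C w) := congrArg (fun L : E →L[ℝ] E => L w) h
  rw [compContinuousLinearMap_apply, derivationExt_apply, derivationExt_apply]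
  refine Finset.sum_congr rfl fun i _ => ?_
  rw [compContinuousLinearMap_apply]
  refine congrArg β (funext fun j => ?_)
  rcases eq_or_ne j i with rfl | hj
  · simp [h']
  · simp [hj]

theorem derivationExt_smulRight_sq {α : E →L[ℝ] ℝ} {v : E} (h : α v = 0)
    (β : E [⋀^Fin k]→L[ℝ] ℝ) :
    derivationExt (α.smulRight v) (derivationExt (α.smulRight v) β) = 0 := by
  ext m
  rw [derivationExt_apply]
  refine Finset.sum_eq_zero fun i _ => ?_
  rw [derivationExt_apply]
  refine Finset.sum_eq_zero fun j _ => ?_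
  rcases eq_or_ne j i with rfl | hj
  · refine β.map_coord_zero j ?_
    simp [h]
  · have : β (Function.update (Function.update m i v) j v) = 0 :=
      β.map_eq_zero_of_eq _ (i := i) (j := j) (by simp [hj.symm]) hj.symm
    simp only [ContinuousLinearMap.smulRight_apply, Function.update_of_ne hj]
    rw [map_update_smul, Function.update_comm hj.symm, map_update_smul,
      Function.update_comm hj, this, smul_zero, smul_zero]

theorem derivationExt_smulRight (α : E →L[ℝ] ℝ) (v : E) (β : E [⋀^Fin (k + 1)]→L[ℝ] ℝ) :
    alternatizeUncurryFin (α.smulRight (β.curryLeft v)) = derivationExt (α.smulRight v) β := by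
  rw [derivationExt_eq, fderivCompContinuousLinearMap_eq_alternatizeUncurryFin]
  simp only [ContinuousLinearMap.comp_apply, alternatizeUncurryFinCLM_apply]
  congr 1
  ext w
  simp

variable [FiniteDimensional ℝ E]

/-- In finite dimension, the alternating forms embed linearly in a coordinate space. -/
theorem exists_coord_leftInverse (E : Type*) [NormedAddCommGroup E] [NormedSpace ℝ E]
    [FiniteDimensional ℝ E] (k : ℕ) :
    ∃ L : ((Fin k → Fin (Module.finrank ℝ E)) → ℝ) →L[ℝ] (E [⋀^Fin k]→L[ℝ] ℝ),
      ∀ β, L (fun v => β fun i => Module.finBasis ℝ E (v i)) = β := by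
  let ev : (E [⋀^Fin k]→L[ℝ] ℝ) →ₗ[ℝ] ((Fin k → Fin (Module.finrank ℝ E)) → ℝ) :=
    { toFun := fun β v => β fun i => Module.finBasis ℝ E (v i)
      map_add' := fun _ _ => rfl
      map_smul' := fun _ _ => rfl }
  have hinj : Function.Injective ev := fun β γ h =>
    toAlternatingMap_injective <|
      (Module.finBasis ℝ E).ext_alternating fun v _ => congrFun h v
  obtain ⟨L, hL⟩ := LinearMap.exists_leftInverse_of_injective ev (LinearMap.ker_eq_bot.2 hinj)
  exact ⟨LinearMap.toContinuousLinearMap L, fun β => congrArg (fun l : _ →ₗ[ℝ] _ => l β) hL⟩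

instance : FiniteDimensional ℝ (E [⋀^Fin k]→L[ℝ] ℝ) := by
  obtain ⟨L, hL⟩ := exists_coord_leftInverse E k
  exact Module.Finite.of_surjective (L : ((Fin k → Fin (Module.finrank ℝ E)) → ℝ) →ₗ[ℝ] _) fun β =>
    ⟨_, hL β⟩

theorem contDiff_compContinuousLinearMap :
    ContDiff ℝ ∞ fun p : (E [⋀^Fin k]→L[ℝ] ℝ) × (E →L[ℝ] E) => p.1.compContinuousLinearMap p.2 := by
  obtain ⟨L, hL⟩ := exists_coord_leftInverse E k
  have h : ContDiff ℝ ∞ fun p : (E [⋀^Fin k]→L[ℝ] ℝ) × (E →L[ℝ] E) =>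
      fun v : Fin k → Fin (Module.finrank ℝ E) =>
        p.1.compContinuousLinearMap p.2 fun i => Module.finBasis ℝ E (v i) := by
    refine contDiff_pi.2 fun v => ?_
    have h1 : ContDiff ℝ ∞ fun q : (E [⋀^Fin k]→L[ℝ] ℝ) × (Fin k → E) =>
        toContinuousMultilinearMapCLM ℝ q.1 q.2 := by
      have := (toContinuousMultilinearMapCLM ℝ :
        (E [⋀^Fin k]→L[ℝ] ℝ) →L[ℝ] _).analyticOnNhd_uncurry_of_multilinear (s := Set.univ)
      exact this.contDiff
    have h2 : ContDiff ℝ ∞ fun p : (E [⋀^Fin k]→L[ℝ] ℝ) × (E →L[ℝ] E) =>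
        (p.1, fun i => p.2 (Module.finBasis ℝ E (v i))) :=
      contDiff_fst.prodMk (contDiff_pi.2 fun i => contDiff_snd.clm_apply contDiff_const)
    exact h1.comp h2
  convert! L.contDiff.comp h using 2 with p
  exact (hL _).symm

end ContinuousAlternatingMap

namespace PeriodicFlow

variable {E : Type u} [NormedAddCommGroup E] [NormedSpace ℝ E]
  {M : Type*} [TopologicalSpace M] [ChartedSpace E M] [IsManifold 𝓘(ℝ, E) ∞ M] {k : ℕ}

/-- The identification of the model space with the tangent space at `x` given by the chart at
`x₀`. -/
noncomputable def frame (x₀ x : M) : E →L[ℝ] E :=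
  (trivializationAt E (TangentSpace 𝓘(ℝ, E)) x₀).symmL ℝ x

/-- The identification of the tangent space at `x` with the model space given by the chart at
`x₀`. -/
noncomputable def coframe (x₀ x : M) : E →L[ℝ] E :=
  (trivializationAt E (TangentSpace 𝓘(ℝ, E)) x₀).continuousLinearMapAt ℝ x

omit [IsManifold 𝓘(ℝ, E) ∞ M] in
theorem mem_baseSet_iff {x₀ x : M} [IsManifold 𝓘(ℝ, E) 1 M] :
    x ∈ (trivializationAt E (TangentSpace 𝓘(ℝ, E)) x₀).baseSet ↔ x ∈ (chartAt E x₀).source := by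
  rw [TangentBundle.trivializationAt_baseSet]

theorem frame_comp_coframe {x₀ x : M} (hx : x ∈ (chartAt E x₀).source) :
    frame x₀ x ∘L coframe x₀ x = .id ℝ E := by
  ext v
  exact (trivializationAt E (TangentSpace 𝓘(ℝ, E)) x₀).symmL_continuousLinearMapAt
    (mem_baseSet_iff.2 hx) v

theorem frame_self (x : M) : frame x x = .id ℝ E := by
  ext v
  have h := TangentBundle.symmL_trivializationAt_eq_core (I := 𝓘(ℝ, E)) (mem_chart_source E x)
  have h2 := tangentCoordChange_self (I := 𝓘(ℝ, E)) (x := x) (v := v) (mem_extChartAt_source x)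
  exact (congrArg (fun L : E →L[ℝ] E => L v) h).trans h2

theorem contMDiffAt_coframe_comp_frame {x₀ x₁ x : M} (h₀ : x ∈ (chartAt E x₀).source)
    (h₁ : x ∈ (chartAt E x₁).source) :
    ContMDiffAt 𝓘(ℝ, E) 𝓘(ℝ, E →L[ℝ] E) ∞ (fun y : M => (coframe x₁ y ∘L frame x₀ y : E →L[ℝ] E)) x := by
  have h := contMDiffAt_coordChangeL (n := ∞) (IB := 𝓘(ℝ, E))
    (e := trivializationAt E (TangentSpace 𝓘(ℝ, E)) x₀)
    (e' := trivializationAt E (TangentSpace 𝓘(ℝ, E)) x₁)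
    (mem_baseSet_iff.2 h₀) (mem_baseSet_iff.2 h₁)
  refine h.congr_of_eventuallyEq ?_
  filter_upwards [(chartAt E x₀).open_source.mem_nhds h₀, (chartAt E x₁).open_source.mem_nhds h₁]
    with y hy₀ hy₁
  ext v
  rw [ContinuousLinearEquiv.coe_coe, Bundle.Trivialization.coordChangeL_apply (R := ℝ) _ _
    ⟨mem_baseSet_iff.2 hy₀, mem_baseSet_iff.2 hy₁⟩,
    ← Bundle.Trivialization.symmL_apply (R := ℝ) _ (mem_baseSet_iff.2 hy₀)]
  exact Bundle.Trivialization.continuousLinearMapAt_apply_of_mem (R := ℝ) _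
    (mem_baseSet_iff.2 hy₁) _

/-- The value of a form at a point, as an alternating form on the model space. -/
def formAt (θ : DForm E M k) (x : M) : E [⋀^Fin k]→L[ℝ] ℝ := θ x

/-- The derivative of a map of `M` to itself, as an endomorphism of the model space. -/
noncomputable def tderiv (f : M → M) (x : M) : E →L[ℝ] E := mfderiv 𝓘(ℝ, E) 𝓘(ℝ, E) f x

omit [IsManifold 𝓘(ℝ, E) ∞ M] in
theorem formAt_pullback (f : M → M) (θ : DForm E M k) (x : M) :
    formAt (pullback f θ) x = (formAt θ (f x)).compContinuousLinearMap (tderiv f x) := rfl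

/-- The coordinates of a form in the chart at `x₀`. -/
noncomputable def formCoord (θ : DForm E M k) (x₀ x : M) : E [⋀^Fin k]→L[ℝ] ℝ :=
  (formAt θ x).compContinuousLinearMap (frame x₀ x)

theorem formCoord_self (θ : DForm E M k) (x : M) : formCoord θ x x = formAt θ x := by
  rw [formCoord, frame_self]
  rfl

theorem smoothForm_iff {θ : DForm E M k} :
    SmoothForm θ ↔
      ∀ x₀, ContMDiffAt 𝓘(ℝ, E) 𝓘(ℝ, E [⋀^Fin k]→L[ℝ] ℝ) ∞ (formCoord θ x₀) x₀ := by
  refine forall_congr' fun x₀ => ?_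
  rw [Bundle.contMDiffAt_section]
  have : (fun x => ((trivializationAt (E [⋀^Fin k]→L[ℝ] ℝ)
      (fun y : M => TangentSpace 𝓘(ℝ, E) y [⋀^Fin k]→L[ℝ] Bundle.Trivial M ℝ y) x₀)
        ⟨x, θ x⟩).2) = formCoord θ x₀ := by
    ext x v
    rw [FiberBundle.trivializationAt_continuousAlternatingMap_apply]
    change ((trivializationAt ℝ (Bundle.Trivial M ℝ) x₀).continuousLinearMapAt ℝ x)
      (formCoord θ x₀ x v) = _
    exact congrArg (fun L : ℝ →L[ℝ] ℝ => L (formCoord θ x₀ x v))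
      (Bundle.Trivial.continuousLinearMapAt_trivialization ℝ M ℝ x)
  rw [← this]

theorem compContinuousLinearMap_comp (β : E [⋀^Fin k]→L[ℝ] ℝ) (A B : E →L[ℝ] E) :
    (β.compContinuousLinearMap A).compContinuousLinearMap B
      = β.compContinuousLinearMap (A ∘L B) := rfl

variable [FiniteDimensional ℝ E]

theorem _root_.ContMDiffAt.compContinuousLinearMap {N : Type*} [TopologicalSpace N] {H F : Type*}
    [TopologicalSpace H] [NormedAddCommGroup F] [NormedSpace ℝ F] [ChartedSpace H N]
    {J : ModelWithCorners ℝ F H} {β : N → E [⋀^Fin k]→L[ℝ] ℝ} {A : N → E →L[ℝ] E} {p : N}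
    (hβ : ContMDiffAt J 𝓘(ℝ, E [⋀^Fin k]→L[ℝ] ℝ) ∞ β p)
    (hA : ContMDiffAt J 𝓘(ℝ, E →L[ℝ] E) ∞ A p) :
    ContMDiffAt J 𝓘(ℝ, E [⋀^Fin k]→L[ℝ] ℝ) ∞
      (fun q => (β q).compContinuousLinearMap (A q)) p := by
  have h := (ContinuousAlternatingMap.contDiff_compContinuousLinearMap (E := E)
    (k := k)).contMDiff.contMDiffAt (x := (β p, A p))
  exact h.comp p (hβ.prodMk_space hA)

theorem SmoothForm.contMDiffAt_formCoord {θ : DForm E M k} (hθ : SmoothForm θ) {x₀ x : M}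
    (hx : x ∈ (chartAt E x₀).source) :
    ContMDiffAt 𝓘(ℝ, E) 𝓘(ℝ, E [⋀^Fin k]→L[ℝ] ℝ) ∞ (formCoord θ x₀) x := by
  have h1 := (smoothForm_iff.1 hθ x).compContinuousLinearMap
    (contMDiffAt_coframe_comp_frame hx (mem_chart_source E x))
  refine h1.congr_of_eventuallyEq ?_
  filter_upwards [(chartAt E x).open_source.mem_nhds (mem_chart_source E x)] with y hy
  rw [formCoord, formCoord, compContinuousLinearMap_comp, ← ContinuousLinearMap.comp_assoc,
    frame_comp_coframe hy, ContinuousLinearMap.id_comp]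

/-- The pullback of a smooth form under a smooth family of maps depends smoothly on the
parameter and the point. -/
theorem SmoothForm.contMDiffAt_formCoord_pullback {θ : DForm E M k} (hθ : SmoothForm θ)
    {φ : ℝ → M → M}
    (hφ : ContMDiff (𝓘(ℝ, ℝ).prod 𝓘(ℝ, E)) 𝓘(ℝ, E) ∞ (fun p : ℝ × M => φ p.1 p.2))
    {x₀ : M} {t : ℝ} {x : M} (hx : x ∈ (chartAt E x₀).source) :
    ContMDiffAt (𝓘(ℝ, ℝ).prod 𝓘(ℝ, E)) 𝓘(ℝ, E [⋀^Fin k]→L[ℝ] ℝ) ∞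
      (fun p : ℝ × M => formCoord (pullback (φ p.1) θ) x₀ p.2) (t, x) := by
  have hD : ContMDiffAt (𝓘(ℝ, ℝ).prod 𝓘(ℝ, E)) 𝓘(ℝ, E →L[ℝ] E) ∞
      (fun p : ℝ × M => coframe (φ t x) (φ p.1 p.2) ∘L
        (tderiv (φ p.1) p.2 ∘L frame x p.2)) (t, x) :=
    ContMDiffAt.mfderiv (n := ∞) (m := ∞) (x₀ := (t, x)) (fun (p : ℝ × M) y => φ p.1 y) Prod.snd
      (ContMDiffAt.comp ((t, x), x) (g := fun p : ℝ × M => φ p.1 p.2)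
        (f := fun q : (ℝ × M) × M => (q.1.1, q.2)) (hφ (t, x))
        (ContMDiffAt.prodMk (ContMDiffAt.fst contMDiffAt_fst) contMDiffAt_snd))
      contMDiffAt_snd (by simp)
  have hc : ContMDiffAt (𝓘(ℝ, ℝ).prod 𝓘(ℝ, E)) 𝓘(ℝ, E →L[ℝ] E) ∞
      (fun p : ℝ × M => coframe x p.2 ∘L frame x₀ p.2) (t, x) :=
    ContMDiffAt.comp (t, x) (g := fun y : M => (coframe x y ∘L frame x₀ y : E →L[ℝ] E)) (f := Prod.snd)
      (contMDiffAt_coframe_comp_frame hx (mem_chart_source E x)) contMDiffAt_snd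
  have hθ' : ContMDiffAt (𝓘(ℝ, ℝ).prod 𝓘(ℝ, E)) 𝓘(ℝ, E [⋀^Fin k]→L[ℝ] ℝ) ∞
      (fun p : ℝ × M => formCoord θ (φ t x) (φ p.1 p.2)) (t, x) :=
    ContMDiffAt.comp (t, x) (g := formCoord θ (φ t x)) (f := fun p : ℝ × M => φ p.1 p.2)
      (hθ.contMDiffAt_formCoord (mem_chart_source E _)) (hφ (t, x))
  refine (hθ'.compContinuousLinearMap (hD.clm_comp hc)).congr_of_eventuallyEq ?_
  have h1 : ∀ᶠ p : ℝ × M in 𝓝 (t, x), p.2 ∈ (chartAt E x).source :=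
    continuousAt_snd.eventually ((chartAt E x).open_source.mem_nhds (mem_chart_source E x))
  have h2 : ∀ᶠ p : ℝ × M in 𝓝 (t, x), φ p.1 p.2 ∈ (chartAt E (φ t x)).source :=
    (hφ (t, x)).continuousAt.eventually
      ((chartAt E (φ t x)).open_source.mem_nhds (mem_chart_source E _))
  filter_upwards [h1, h2] with p hp1 hp2
  simp only [formCoord, formAt_pullback, compContinuousLinearMap_comp]
  congr 1
  ext w
  have e1 (w : E) : frame x p.2 (coframe x p.2 w) = w :=
    congrArg (fun L : E →L[ℝ] E => L w) (frame_comp_coframe hp1)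
  have e2 (w : E) : frame (φ t x) (φ p.1 p.2) (coframe (φ t x) (φ p.1 p.2) w) = w :=
    congrArg (fun L : E →L[ℝ] E => L w) (frame_comp_coframe hp2)
  simp only [ContinuousLinearMap.comp_apply, e1, e2]

end PeriodicFlow

namespace PeriodicFlow

variable {E : Type u} [NormedAddCommGroup E] [NormedSpace ℝ E]
  {M : Type*} [TopologicalSpace M] [ChartedSpace E M] [IsManifold 𝓘(ℝ, E) ∞ M] {k : ℕ}

omit [IsManifold 𝓘(ℝ, E) ∞ M] in
@[ext]
theorem DForm.ext_formAt {θ θ' : DForm E M k} (h : ∀ x, formAt θ x = formAt θ' x) : θ = θ' :=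
  funext h

section Algebra

omit [IsManifold 𝓘(ℝ, E) ∞ M]

/-- The value of a vector field at a point, as a vector of the model space. -/
def fieldAt (X : VField E M) (x : M) : E := X x

/-- The value of a covector field at a point, as a linear form on the model space. -/
def covAt (α : CovField E M) (x : M) : E →L[ℝ] ℝ := α x

theorem formAt_covWedge_interiorProd (α : CovField E M) (X : VField E M) (θ : DForm E M k) (x : M) :
    formAt (covWedge α (interiorProd X θ)) x =
      ContinuousAlternatingMap.derivationExt ((covAt α x).smulRight (fieldAt X x))
        (formAt θ x) := by
  cases k with
  | zero =>
    refine (ContinuousAlternatingMap.ext fun v => ?_)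
    rw [ContinuousAlternatingMap.derivationExt_apply]
    rfl
  | succ k => exact ContinuousAlternatingMap.derivationExt_smulRight _ _ _

end Algebra

section Smooth

theorem SmoothVField.contMDiffAt_coframe {X : VField E M} (hX : SmoothVField X) (x₀ : M) :
    ContMDiffAt 𝓘(ℝ, E) 𝓘(ℝ, E) ∞ (fun x => coframe x₀ x (fieldAt X x)) x₀ := by
  refine ((Bundle.contMDiffAt_section x₀).1 (hX x₀)).congr_of_eventuallyEq ?_
  filter_upwards [(chartAt E x₀).open_source.mem_nhds (mem_chart_source E x₀)] with x hx
  exact Bundle.Trivialization.continuousLinearMapAt_apply_of_mem (R := ℝ) _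
    (mem_baseSet_iff.2 hx) _

theorem contMDiffAt_differential_comp_frame {f : M → ℝ} (hf : ContMDiff 𝓘(ℝ, E) 𝓘(ℝ, ℝ) ∞ f)
    (x₀ : M) :
    ContMDiffAt 𝓘(ℝ, E) 𝓘(ℝ, E →L[ℝ] ℝ) ∞
      (fun x : M => (covAt (differential f) x ∘L frame x₀ x : E →L[ℝ] ℝ)) x₀ := by
  have h := (hf x₀).mfderiv_const (m := ∞) (by simp)
  refine h.congr_of_eventuallyEq (Filter.Eventually.of_forall fun x => ?_)
  ext v
  change _ = (trivializationAt ℝ (TangentSpace 𝓘(ℝ, ℝ)) (f x₀)).continuousLinearMapAt ℝ (f x)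
    (covAt (differential f) x (frame x₀ x v))
  rw [TangentBundle.continuousLinearMapAt_model_space]
  rfl

theorem smoothForm_covWedge_interiorProd {f : M → ℝ} (hf : ContMDiff 𝓘(ℝ, E) 𝓘(ℝ, ℝ) ∞ f)
    {X : VField E M} (hX : SmoothVField X) {θ : DForm E M k} (hθ : SmoothForm θ) :
    SmoothForm (covWedge (differential f) (interiorProd X θ)) := by
  rw [smoothForm_iff] at hθ ⊢
  intro x₀
  have h1 : ContMDiffAt 𝓘(ℝ, E) 𝓘(ℝ, E →L[ℝ] E) ∞
      (fun x : M => ContinuousLinearMap.smulRightL ℝ E E (covAt (differential f) x ∘L frame x₀ x)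
        (coframe x₀ x (fieldAt X x))) x₀ :=
    (ContMDiffAt.clm_apply contMDiffAt_const (contMDiffAt_differential_comp_frame hf x₀)).clm_apply
      (hX.contMDiffAt_coframe x₀)
  have h2 : ContMDiffAt 𝓘(ℝ, E) 𝓘(ℝ, E [⋀^Fin k]→L[ℝ] ℝ) ∞
      (fun x : M => ContinuousAlternatingMap.derivationExt
        (ContinuousLinearMap.smulRightL ℝ E E (covAt (differential f) x ∘L frame x₀ x)
          (coframe x₀ x (fieldAt X x))) (formCoord θ x₀ x)) x₀ :=
    (ContMDiffAt.clm_apply contMDiffAt_const h1).clm_apply (hθ x₀)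
  refine h2.congr_of_eventuallyEq ?_
  filter_upwards [(chartAt E x₀).open_source.mem_nhds (mem_chart_source E x₀)] with x hx
  rw [formCoord, formAt_covWedge_interiorProd]
  refine ContinuousAlternatingMap.derivationExt_compContinuousLinearMap ?_ _
  ext w
  have e1 (w : E) : frame x₀ x (coframe x₀ x w) = w :=
    congrArg (fun L : E →L[ℝ] E => L w) (frame_comp_coframe hx)
  simp [e1]

theorem SmoothForm.add {θ θ' : DForm E M k} (h : SmoothForm θ) (h' : SmoothForm θ') :
    SmoothForm (θ + θ') := by
  rw [smoothForm_iff] at h h' ⊢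
  exact fun x₀ => (h x₀).add (h' x₀)

theorem SmoothForm.sub {θ θ' : DForm E M k} (h : SmoothForm θ) (h' : SmoothForm θ') :
    SmoothForm (θ - θ') := by
  rw [smoothForm_iff] at h h' ⊢
  exact fun x₀ => (h x₀).sub (h' x₀)

theorem SmoothForm.smul {f : M → ℝ} (hf : ContMDiff 𝓘(ℝ, E) 𝓘(ℝ, ℝ) ∞ f) {θ : DForm E M k}
    (h : SmoothForm θ) : SmoothForm (fun x => f x • θ x : DForm E M k) := by
  rw [smoothForm_iff] at h ⊢
  exact fun x₀ => (hf x₀).smul (h x₀)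

end Smooth

section Flow

variable [T2Space M] [FiniteDimensional ℝ E] {Y : VField E M}

theorem SmoothForm.contDiff_formAt_pullback_flow {θ : DForm E M k} (hθ : SmoothForm θ)
    (hY : SmoothVField Y) (hc : CompleteVField Y) (x : M) :
    ContDiff ℝ ∞ (fun t => formAt (pullback (flow Y t) θ) x) := by
  rw [← contMDiff_iff_contDiff]
  intro t
  have h := hθ.contMDiffAt_formCoord_pullback (hY.contMDiff_flow hc) (t := t)
    (mem_chart_source E x)
  have h2 := ContMDiffAt.comp t (f := fun t : ℝ => (t, x)) h
    (contMDiffAt_id.prodMk contMDiffAt_const)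
  refine h2.congr_of_eventuallyEq (Filter.Eventually.of_forall fun s => ?_)
  exact (formCoord_self _ _).symm

theorem compContinuousLinearMap_formAt_flowIntegral {θ : DForm E M k} (hθ : SmoothForm θ)
    (hY : SmoothVField Y) (hc : CompleteVField Y) {c : ℝ → ℝ} (hcont : Continuous c) (x : M)
    (A : E →L[ℝ] E) :
    (formAt (flowIntegral Y c θ) x).compContinuousLinearMap A =
      ∫ t in (0 : ℝ)..(2 * Real.pi),
        c t • (formAt (pullback (flow Y t) θ) x).compContinuousLinearMap A := by
  have := (ContinuousAlternatingMap.compContinuousLinearMapCLM A :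
    (E [⋀^Fin k]→L[ℝ] ℝ) →L[ℝ] _).intervalIntegral_comp_comm (μ := MeasureTheory.volume)
    (((hcont.smul (hθ.contDiff_formAt_pullback_flow hY hc x).continuous)).intervalIntegrable
      0 (2 * Real.pi))
  exact this.symm

theorem SmoothForm.flowIntegral {θ : DForm E M k} (hθ : SmoothForm θ)
    (hY : SmoothVField Y) (hc : CompleteVField Y) {c : ℝ → ℝ} (hcs : ContDiff ℝ ∞ c) :
    SmoothForm (flowIntegral Y c θ) := by
  rw [smoothForm_iff]
  intro x₀
  set e := extChartAt 𝓘(ℝ, E) x₀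
  have hF : ContDiffOn ℝ ∞ (fun p : ℝ × E =>
      c p.1 • formCoord (pullback (flow Y p.1) θ) x₀ (e.symm p.2)) (Set.univ ×ˢ e.target) := by
    rw [← contMDiffOn_iff_contDiffOn, modelWithCornersSelf_prod, ← chartedSpaceSelf_prod]
    rintro ⟨t, y⟩ ⟨-, hy⟩
    have hsrc : e.symm y ∈ (chartAt E x₀).source := by
      have := e.map_target hy
      rwa [extChartAt_source] at this
    have h1 := hθ.contMDiffAt_formCoord_pullback (hY.contMDiff_flow hc) (t := t) hsrc
    have h2 : ContMDiffAt (𝓘(ℝ, ℝ).prod 𝓘(ℝ, E)) (𝓘(ℝ, ℝ).prod 𝓘(ℝ, E)) ∞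
        (fun p : ℝ × E => (p.1, e.symm p.2)) (t, y) :=
      contMDiffAt_fst.prodMk (ContMDiffAt.comp (t, y)
        ((contMDiffOn_extChartAt_symm x₀).contMDiffAt
          ((isOpen_extChartAt_target x₀).mem_nhds hy)) contMDiffAt_snd)
    have h3 : ContMDiffAt (𝓘(ℝ, ℝ).prod 𝓘(ℝ, E)) 𝓘(ℝ, ℝ) ∞ (fun p : ℝ × E => c p.1) (t, y) :=
      ContMDiffAt.comp (t, y) hcs.contMDiff.contMDiffAt contMDiffAt_fst
    exact (h3.smul (ContMDiffAt.comp (t, y) h1 h2)).contMDiffWithinAt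
  have hI := (hF.contDiffAt_intervalIntegral (isOpen_extChartAt_target x₀)
    (by positivity : (0 : ℝ) ≤ 2 * Real.pi) (mem_extChartAt_target x₀)).contMDiffAt
  have hfin := ContMDiffAt.comp x₀ hI (contMDiffAt_extChartAt (I := 𝓘(ℝ, E)) (n := ∞))
  refine hfin.congr_of_eventuallyEq ?_
  filter_upwards [extChartAt_source_mem_nhds (I := 𝓘(ℝ, E)) x₀] with x hx
  rw [formCoord, compContinuousLinearMap_formAt_flowIntegral hθ hY hc hcs.continuous]
  simp only [Function.comp_apply]
  rw [e.left_inv hx]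
  rfl

end Flow

end PeriodicFlow

namespace PeriodicFlow

variable {E : Type u} [NormedAddCommGroup E] [NormedSpace ℝ E]
  {M : Type*} [TopologicalSpace M] [ChartedSpace E M] [IsManifold 𝓘(ℝ, E) ∞ M] {k : ℕ}
  [T2Space M] [FiniteDimensional ℝ E] {Y : VField E M}

theorem SmoothVField.contMDiff_flow_time (hY : SmoothVField Y) (hc : CompleteVField Y) (t : ℝ) :
    ContMDiff 𝓘(ℝ, E) 𝓘(ℝ, E) ∞ (flow Y t) :=
  (hY.contMDiff_flow hc).comp (contMDiff_const.prodMk contMDiff_id)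

theorem SmoothVField.mdifferentiableAt_flow (hY : SmoothVField Y) (hc : CompleteVField Y) (t : ℝ)
    (x : M) : MDifferentiableAt 𝓘(ℝ, E) 𝓘(ℝ, E) (flow Y t) x :=
  (hY.contMDiff_flow_time hc t x).mdifferentiableAt (by simp)

omit [T2Space M] [FiniteDimensional ℝ E] [IsManifold 𝓘(ℝ, E) ∞ M] in
theorem tderiv_comp {f g : M → M} {x : M} (hf : MDifferentiableAt 𝓘(ℝ, E) 𝓘(ℝ, E) f (g x))
    (hg : MDifferentiableAt 𝓘(ℝ, E) 𝓘(ℝ, E) g x) :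
    tderiv (f ∘ g) x = tderiv f (g x) ∘L tderiv (E := E) g x :=
  mfderiv_comp x hf hg

theorem SmoothVField.pullback_pullback_flow (hY : SmoothVField Y) (hc : CompleteVField Y)
    (s t : ℝ) (θ : DForm E M k) :
    pullback (flow Y s) (pullback (flow Y t) θ) = pullback (flow Y (t + s)) θ := by
  ext x
  have h : flow Y (t + s) = flow Y t ∘ flow Y s := funext fun x => hY.flow_add hc t s x
  rw [formAt_pullback, formAt_pullback, formAt_pullback, compContinuousLinearMap_comp, h,
    tderiv_comp (hY.mdifferentiableAt_flow hc t _) (hY.mdifferentiableAt_flow hc s x)]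
  rfl

omit [T2Space M] [FiniteDimensional ℝ E] [IsManifold 𝓘(ℝ, E) ∞ M] in
theorem CompleteVField.pullback_flow_zero (hc : CompleteVField Y) (θ : DForm E M k) :
    pullback (flow Y 0) θ = θ := by
  have h : flow Y 0 = id := funext fun x => hc.flow_zero x
  ext x
  rw [formAt_pullback, h, tderiv, mfderiv_id]
  rfl

omit [T2Space M] [FiniteDimensional ℝ E] [IsManifold 𝓘(ℝ, E) ∞ M] in
/-- The velocity of the composition of an integral curve with a differentiable map. -/
theorem hasMFDerivAt_comp_flow {F : Type*} [NormedAddCommGroup F] [NormedSpace ℝ F] {N : Type*}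
    [TopologicalSpace N] [ChartedSpace F N] (hc : CompleteVField Y) {f : M → N} {t : ℝ} {x : M}
    {D : E →L[ℝ] F} (hf : HasMFDerivAt 𝓘(ℝ, E) 𝓘(ℝ, F) f (flow Y t x) D) :
    HasMFDerivAt 𝓘(ℝ, ℝ) 𝓘(ℝ, F) (fun s => f (flow Y s x)) t
      ((1 : ℝ →L[ℝ] ℝ).smulRight (D (fieldAt Y (flow Y t x)))) := by
  refine (hf.comp t (hc.isMIntegralCurve_flow x t)).congr_mfderiv
    (ContinuousLinearMap.ext fun (r : ℝ) => ?_)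
  exact D.map_smul r _

omit [T2Space M] [FiniteDimensional ℝ E] [IsManifold 𝓘(ℝ, E) ∞ M] in
theorem CompleteVField.hasDerivAt_comp_flow (hc : CompleteVField Y) {f : M → ℝ} {t : ℝ} {x : M}
    (hf : MDifferentiableAt 𝓘(ℝ, E) 𝓘(ℝ, ℝ) f (flow Y t x)) :
    HasDerivAt (fun s => f (flow Y s x))
      (covAt (differential f) (flow Y t x) (fieldAt Y (flow Y t x))) t := by
  have h := hasMFDerivAt_comp_flow hc (D := covAt (differential f) (flow Y t x)) hf.hasMFDerivAt
  have h' : HasFDerivAt (fun s => f (flow Y s x)) ((1 : ℝ →L[ℝ] ℝ).smulRight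
      (covAt (differential f) (flow Y t x) (fieldAt Y (flow Y t x)))) t :=
    hasMFDerivAt_iff_hasFDerivAt.1 h
  simpa using h'.hasDerivAt

/-- A vector field is invariant under its flow. -/
theorem SmoothVField.tderiv_flow_fieldAt (hY : SmoothVField Y) (hc : CompleteVField Y) (t : ℝ)
    (x : M) : tderiv (flow Y t) x (fieldAt Y x) = fieldAt Y (flow Y t x) := by
  have hf (D : E →L[ℝ] E) (hD : D = tderiv (flow Y t) (flow Y 0 x)) :
      HasMFDerivAt 𝓘(ℝ, E) 𝓘(ℝ, E) (flow Y t) (flow Y 0 x) D := by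
    subst hD
    exact (hY.mdifferentiableAt_flow hc t _).hasMFDerivAt
  have h1 := hasMFDerivAt_comp_flow hc (hf _ rfl)
  have h2 := (hc.isMIntegralCurve_flow (flow Y t x)) 0
  have h3 : (fun s => flow Y t (flow Y s x)) = fun s => flow Y s (flow Y t x) := by
    ext s
    rw [← hY.flow_add hc, ← hY.flow_add hc, add_comm]
  rw [h3] at h1
  have h4 := hasMFDerivAt_unique h1 h2
  have h5 := congrArg (fun L : ℝ →L[ℝ] E => L 1) h4
  have h6 : (1 : ℝ) • tderiv (flow Y t) (flow Y 0 x) (fieldAt Y (flow Y 0 x)) =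
    (1 : ℝ) • fieldAt Y (flow Y 0 (flow Y t x)) := h5
  rwa [one_smul, one_smul, hc.flow_zero, hc.flow_zero] at h6

/-- The differential of a function that is constant along the flow is invariant. -/
theorem SmoothVField.covAt_differential_comp_tderiv_flow (hY : SmoothVField Y)
    (hc : CompleteVField Y) {f : M → ℝ} (hf : MDifferentiable 𝓘(ℝ, E) 𝓘(ℝ, ℝ) f)
    (hinv : ∀ t x, f (flow Y t x) = f x) (t : ℝ) (x : M) :
    (covAt (differential f) (flow Y t x) ∘L tderiv (E := E) (flow Y t) x : E →L[ℝ] ℝ) =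
      covAt (E := E) (differential f) x := by
  have h := mfderiv_comp x (hf (flow Y t x)) (hY.mdifferentiableAt_flow hc t x)
  have h2 : f ∘ flow Y t = f := funext fun x => hinv t x
  rw [h2] at h
  exact h.symm

omit [T2Space M] [FiniteDimensional ℝ E] [IsManifold 𝓘(ℝ, E) ∞ M] in
theorem CompleteVField.covAt_differential_fieldAt (hc : CompleteVField Y) {f : M → ℝ}
    (hf : MDifferentiable 𝓘(ℝ, E) 𝓘(ℝ, ℝ) f) (hinv : ∀ t x, f (flow Y t x) = f x) (x : M) :
    covAt (differential f) x (fieldAt Y x) = 0 := by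
  have h := hc.hasDerivAt_comp_flow (t := 0) (x := x) (hf _)
  simp only [hinv] at h
  rw [hc.flow_zero] at h
  exact h.unique (hasDerivAt_const _ _)

/-- The operator `θ ↦ df ∧ i_Y θ` commutes with the flow of `Y` if `f` is invariant. -/
theorem SmoothVField.formAt_pullback_flow_derivationExt (hY : SmoothVField Y)
    (hc : CompleteVField Y) {f : M → ℝ} (hf : MDifferentiable 𝓘(ℝ, E) 𝓘(ℝ, ℝ) f)
    (hinv : ∀ t x, f (flow Y t x) = f x) (θ : DForm E M k) (t : ℝ) (x : M) :
    formAt (pullback (flow Y t) (covWedge (differential f) (interiorProd Y θ))) x =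
      ContinuousAlternatingMap.derivationExt
        ((covAt (differential f) x).smulRight (fieldAt Y x)) (formAt (pullback (flow Y t) θ) x) := by
  rw [formAt_pullback, formAt_pullback, formAt_covWedge_interiorProd]
  refine ContinuousAlternatingMap.derivationExt_compContinuousLinearMap ?_ _
  rw [← hY.covAt_differential_comp_tderiv_flow hc hf hinv t x]
  ext w
  simp [hY.tderiv_flow_fieldAt hc]

section Integrals

theorem SmoothVField.formAt_pullback_flow_flowIntegral (hY : SmoothVField Y)
    (hc : CompleteVField Y) {c : ℝ → ℝ} (hcont : Continuous c) {θ : DForm E M k}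
    (hθ : SmoothForm θ) (s : ℝ) (x : M) :
    formAt (pullback (flow Y s) (flowIntegral Y c θ)) x =
      ∫ t in (0 : ℝ)..(2 * Real.pi), c t • formAt (pullback (flow Y (t + s)) θ) x := by
  rw [formAt_pullback, compContinuousLinearMap_formAt_flowIntegral hθ hY hc hcont]
  refine intervalIntegral.integral_congr fun t _ => ?_
  rw [← formAt_pullback, hY.pullback_pullback_flow hc]

omit [T2Space M] [FiniteDimensional ℝ E] [IsManifold 𝓘(ℝ, E) ∞ M] in
theorem formAt_pullback_smul (f : M → M) (r : ℝ) (θ : DForm E M k) (x : M) :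
    formAt (pullback f (r • θ)) x = r • formAt (pullback f θ) x := rfl

theorem SmoothForm.opS (hY : SmoothVField Y) (hc : CompleteVField Y) {θ : DForm E M k}
    (hθ : SmoothForm θ) : SmoothForm (opS Y θ) :=
  (hθ.flowIntegral hY hc (contDiff_id.sub contDiff_const)).smul
    (f := fun _ => 1 / (2 * Real.pi)) contMDiff_const

theorem SmoothForm.average (hY : SmoothVField Y) (hc : CompleteVField Y) {θ : DForm E M k}
    (hθ : SmoothForm θ) : SmoothForm (average Y θ) :=
  (hθ.flowIntegral hY hc contDiff_const).smul
    (f := fun _ => 1 / (2 * Real.pi)) contMDiff_const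

/-- The operator `𝒮` commutes with the interior product by an invariant vector field. -/
theorem SmoothVField.opS_interiorProd (hY : SmoothVField Y) (hc : CompleteVField Y)
    {Z : VField E M} (hZ : ∀ t x, tderiv (flow Y t) x (fieldAt Z x) = fieldAt Z (flow Y t x))
    {θ : DForm E M k} (hθ : SmoothForm θ) :
    PeriodicFlow.opS Y (interiorProd Z θ) = interiorProd Z (PeriodicFlow.opS Y θ) := by
  cases k with
  | zero =>
    refine DForm.ext_formAt fun x => ?_
    change (1 / (2 * Real.pi)) • (∫ t in (0 : ℝ)..(2 * Real.pi), (t - Real.pi) •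
      (0 : E [⋀^Fin 0]→L[ℝ] ℝ)) = 0
    simp
  | succ k =>
    refine DForm.ext_formAt fun x => ?_
    let L : (E [⋀^Fin (k + 1)]→L[ℝ] ℝ) →L[ℝ] (E [⋀^Fin k]→L[ℝ] ℝ) :=
      (ContinuousLinearMap.apply ℝ (E [⋀^Fin k]→L[ℝ] ℝ) (fieldAt Z x)).comp
        (ContinuousAlternatingMap.curryLeftLI (𝕜 := ℝ) (E := E) (F := ℝ) (n := k)).toContinuousLinearMap
    have hL (ξ : DForm E M (k + 1)) : formAt (interiorProd Z ξ) x = L (formAt ξ x) := rfl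
    have hP (t : ℝ) : formAt (pullback (flow Y t) (interiorProd Z θ)) x =
        L (formAt (pullback (flow Y t) θ) x) := by
      refine ContinuousAlternatingMap.ext fun v => ?_
      change formAt θ (flow Y t x) (Fin.cons (fieldAt Z (flow Y t x)) fun i =>
          tderiv (flow Y t) x (v i)) =
        formAt θ (flow Y t x) fun i => tderiv (flow Y t) x (Matrix.vecCons (fieldAt Z x) v i)
      refine congrArg (formAt θ (flow Y t x)) (funext fun i => ?_)
      refine Fin.cases ?_ (fun i => ?_) i
      · exact (hZ t x).symm
      · rfl
    have hi : ∫ t in (0 : ℝ)..(2 * Real.pi), L ((t - Real.pi) •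
        formAt (pullback (flow Y t) θ) x) = L (∫ t in (0 : ℝ)..(2 * Real.pi), (t - Real.pi) •
        formAt (pullback (flow Y t) θ) x) := L.intervalIntegral_comp_comm (μ := MeasureTheory.volume)
      ((((continuous_id.sub continuous_const).smul
        (hθ.contDiff_formAt_pullback_flow hY hc x).continuous)).intervalIntegrable
          (0 : ℝ) (2 * Real.pi) : IntervalIntegrable (fun t : ℝ => (t - Real.pi) •
            formAt (pullback (flow Y t) θ) x) _ _ _)
    rw [hL]
    change (1 / (2 * Real.pi)) • (∫ t in (0 : ℝ)..(2 * Real.pi), (t - Real.pi) •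
      formAt (pullback (flow Y t) (interiorProd Z θ)) x) = L ((1 / (2 * Real.pi)) •
        ∫ t in (0 : ℝ)..(2 * Real.pi), (t - Real.pi) • formAt (pullback (flow Y t) θ) x)
    rw [map_smul, ← hi]
    simp only [hP, map_smul]

end Integrals

end PeriodicFlow

namespace PeriodicFlow

section PeriodicPrimitive

variable {V : Type*} [NormedAddCommGroup V] [NormedSpace ℝ V] {g : ℝ → V}

/-- The mean of a `2π`-periodic function over a period. -/
noncomputable def periodMean (g : ℝ → V) : V :=
  (1 / (2 * Real.pi)) • ∫ t in (0 : ℝ)..(2 * Real.pi), g t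

/-- The primitive of mean zero of `g - periodMean g`, for a `2π`-periodic function `g`. -/
noncomputable def periodPrimitive (g : ℝ → V) (s : ℝ) : V :=
  (1 / (2 * Real.pi)) • ∫ t in (0 : ℝ)..(2 * Real.pi), (t - Real.pi) • g (t + s)

theorem integral_eq_periodMean (g : ℝ → V) :
    ∫ t in (0 : ℝ)..(2 * Real.pi), g t = (2 * Real.pi) • periodMean g := by
  rw [periodMean, smul_smul, mul_one_div_cancel Real.two_pi_pos.ne', one_smul]

theorem integral_comp_add_eq_periodMean (hp : Function.Periodic g (2 * Real.pi)) (s : ℝ) :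
    ∫ t in (0 : ℝ)..(2 * Real.pi), g (t + s) = (2 * Real.pi) • periodMean g := by
  rw [intervalIntegral.integral_comp_add_right, zero_add, add_comm (2 * Real.pi) s,
    hp.intervalIntegral_add_eq s 0, zero_add, integral_eq_periodMean]

theorem periodPrimitive_periodic (hp : Function.Periodic g (2 * Real.pi)) :
    Function.Periodic (periodPrimitive g) (2 * Real.pi) := by
  intro s
  simp only [periodPrimitive, ← add_assoc, hp _]

variable [CompleteSpace V]

theorem hasDerivAt_periodPrimitive (hg : Continuous g) (hp : Function.Periodic g (2 * Real.pi))
    (s : ℝ) : HasDerivAt (periodPrimitive g) (g s - periodMean g) s := by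
  let h : ℝ → V := fun u => u • g u
  have hh : Continuous h := continuous_id.smul hg
  have hF (u : ℝ) : HasDerivAt (fun r => ∫ t in (0 : ℝ)..r, h t) (h u) u :=
    intervalIntegral.integral_hasDerivAt_right (hh.intervalIntegrable 0 u)
      (hh.stronglyMeasurableAtFilter _ _) hh.continuousAt
  have heq : periodPrimitive g = fun s => (1 / (2 * Real.pi)) •
      ((∫ t in (0 : ℝ)..(s + 2 * Real.pi), h t) - (∫ t in (0 : ℝ)..s, h t)
        - (s + Real.pi) • ((2 * Real.pi) • periodMean g)) := by
    ext s
    rw [periodPrimitive, ← integral_comp_add_eq_periodMean hp s,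
      intervalIntegral.integral_interval_sub_left (hh.intervalIntegrable _ _)
        (hh.intervalIntegrable _ _), ← intervalIntegral.integral_smul (s + Real.pi)]
    have h1 : ∫ t in s..(s + 2 * Real.pi), h t = ∫ t in (0 : ℝ)..(2 * Real.pi), h (t + s) := by
      rw [intervalIntegral.integral_comp_add_right, zero_add, add_comm]
    have hc : Continuous fun t => g (t + s) := hg.comp (continuous_id.add continuous_const)
    have hh' : Continuous fun t => h (t + s) := hh.comp (continuous_id.add continuous_const)
    have hc' : Continuous fun t => (s + Real.pi) • g (t + s) := continuous_const.smul hc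
    rw [h1, ← intervalIntegral.integral_sub (hh'.intervalIntegrable _ _)
      (hc'.intervalIntegrable _ _)]
    congr 1
    refine intervalIntegral.integral_congr fun t _ => ?_
    simp only [h]
    rw [← sub_smul]
    congr 1
    ring
  rw [heq]
  have h2 : HasDerivAt (fun s => ∫ t in (0 : ℝ)..(s + 2 * Real.pi), h t)
      (h (s + 2 * Real.pi)) s := by
    simpa using (hF (s + 2 * Real.pi)).comp_add_const s (2 * Real.pi)
  have h3 : HasDerivAt (fun s : ℝ => (s + Real.pi) • ((2 * Real.pi) • periodMean g))
      ((1 : ℝ) • ((2 * Real.pi) • periodMean g)) s :=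
    ((hasDerivAt_id s).add_const Real.pi).smul_const _
  convert! ((h2.sub (hF s)).sub h3).const_smul (1 / (2 * Real.pi)) using 1
  simp only [h]
  rw [hp s, ← sub_smul, add_sub_cancel_left, one_smul, ← smul_sub, smul_smul,
    one_div_mul_cancel Real.two_pi_pos.ne', one_smul]

theorem continuous_periodPrimitive (hg : Continuous g) (hp : Function.Periodic g (2 * Real.pi)) :
    Continuous (periodPrimitive g) :=
  continuous_iff_continuousAt.2 fun s => (hasDerivAt_periodPrimitive hg hp s).continuousAt

theorem periodMean_periodPrimitive (hg : Continuous g) (hp : Function.Periodic g (2 * Real.pi)) :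
    periodMean (periodPrimitive g) = 0 := by
  have hswap : ∫ s in (0 : ℝ)..(2 * Real.pi), ∫ t in (0 : ℝ)..(2 * Real.pi),
      (t - Real.pi) • g (t + s) = ∫ t in (0 : ℝ)..(2 * Real.pi), ∫ s in (0 : ℝ)..(2 * Real.pi),
      (t - Real.pi) • g (t + s) := by
    refine MeasureTheory.intervalIntegral_intervalIntegral_swap ?_
    have hcont : Continuous (Function.uncurry fun s t : ℝ => (t - Real.pi) • g (t + s)) :=
      (continuous_snd.sub continuous_const).smul
        (hg.comp (continuous_snd.add continuous_fst))
    exact (hcont.continuousOn.integrableOn_compact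
      (isCompact_uIcc.prod isCompact_uIcc)).mono_set
        (Set.prod_mono Set.uIoc_subset_uIcc Set.uIoc_subset_uIcc)
  have hin (t : ℝ) : ∫ s in (0 : ℝ)..(2 * Real.pi), (t - Real.pi) • g (t + s) =
      (t - Real.pi) • ((2 * Real.pi) • periodMean g) := by
    rw [intervalIntegral.integral_smul, ← integral_comp_add_eq_periodMean hp t]
    simp only [add_comm]
  have hz : ∫ t in (0 : ℝ)..(2 * Real.pi), (t - Real.pi) = 0 := by
    rw [intervalIntegral.integral_sub (by simp) (by simp)]
    simp
    ring
  have : ∫ s in (0 : ℝ)..(2 * Real.pi), ∫ t in (0 : ℝ)..(2 * Real.pi),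
      (t - Real.pi) • g (t + s) = 0 := by
    rw [hswap]
    simp only [hin]
    rw [intervalIntegral.integral_smul_const, hz, zero_smul]
  simp only [periodMean, periodPrimitive]
  rw [intervalIntegral.integral_smul, this, smul_zero, smul_zero]

end PeriodicPrimitive

section LinearEquation

variable {V : Type*} [NormedAddCommGroup V] [NormedSpace ℝ V]

theorem eq_of_hasDerivAt_const_of_periodic {h : ℝ → V} {v : V} (hh : ∀ t, HasDerivAt h v t)
    (hp : Function.Periodic h (2 * Real.pi)) : v = 0 ∧ ∀ t, h t = h 0 := by
  have hd (t : ℝ) : HasDerivAt (fun t => h t - t • v) 0 t := by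
    have := (hh t).sub ((hasDerivAt_id t).smul_const v)
    rwa [one_smul, sub_self] at this
  have hc (t : ℝ) : h t - t • v = h 0 := by
    simpa using is_const_of_deriv_eq_zero (fun t => (hd t).differentiableAt)
      (fun t => (hd t).deriv) t 0
  have hv : v = 0 := by
    have h1 := hc (2 * Real.pi)
    rw [← zero_add (2 * Real.pi), hp 0, zero_add, sub_eq_self, smul_eq_zero] at h1
    exact h1.resolve_left Real.two_pi_pos.ne'
  exact ⟨hv, fun t => by simpa [hv] using hc t⟩

variable [CompleteSpace V] {g : ℝ → V} {w : ℝ} {N : V →L[ℝ] V}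

/-- A particular solution of `w f' + N f = g - periodMean g`, where `N² = 0`. -/
noncomputable def periodicSolution (w : ℝ) (N : V →L[ℝ] V) (g : ℝ → V) (t : ℝ) : V :=
  (1 / w) • periodPrimitive g t - (1 / w ^ 2) • N (periodPrimitive (periodPrimitive g) t)

theorem hasDerivAt_periodicSolution (hw : w ≠ 0) (hN : ∀ v, N (N v) = 0) (hg : Continuous g)
    (hp : Function.Periodic g (2 * Real.pi)) (t : ℝ) :
    HasDerivAt (periodicSolution w N g)
      ((1 / w) • (g t - periodMean g - N (periodicSolution w N g t))) t := by
  have h1 := (hasDerivAt_periodPrimitive hg hp t).const_smul (1 / w)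
  have h2 := (N.hasFDerivAt.comp_hasDerivAt t (hasDerivAt_periodPrimitive
    (continuous_periodPrimitive hg hp) (periodPrimitive_periodic hp) t)).const_smul (1 / w ^ 2)
  refine (h1.sub h2).congr_deriv ?_
  rw [periodMean_periodPrimitive hg hp, sub_zero, periodicSolution, map_sub, map_smul, map_smul,
    hN, smul_zero, sub_zero, smul_sub (1 / w) (g t - periodMean g), smul_smul]
  congr 2
  field_simp

omit [CompleteSpace V] in
theorem periodicSolution_periodic (hp : Function.Periodic g (2 * Real.pi)) :
    Function.Periodic (periodicSolution w N g) (2 * Real.pi) := by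
  intro t
  simp only [periodicSolution, periodPrimitive_periodic hp t,
    periodPrimitive_periodic (periodPrimitive_periodic hp) t]

/-- A periodic solution of `w f' + N f = g - c` with `N² = 0` differs by a constant from
the particular solution. -/
theorem exists_eq_periodicSolution_add (hw : w ≠ 0) (hN : ∀ v, N (N v) = 0) (hg : Continuous g)
    (hp : Function.Periodic g (2 * Real.pi)) {f : ℝ → V} {c : V}
    (hfp : Function.Periodic f (2 * Real.pi))
    (hf : ∀ t, HasDerivAt f ((1 / w) • (g t - c - N (f t))) t) :
    ∃ m, c = periodMean g - N m ∧ ∀ t, f t = periodicSolution w N g t + m := by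
  let m : ℝ → V := fun t => f t - periodicSolution w N g t
  have hm (t : ℝ) : HasDerivAt m ((1 / w) • (periodMean g - c - N (m t))) t := by
    refine ((hf t).sub (hasDerivAt_periodicSolution hw hN hg hp t)).congr_deriv ?_
    rw [← smul_sub]
    simp only [m, map_sub]
    congr 1
    abel
  have hmp : Function.Periodic m (2 * Real.pi) := fun t => by
    simp only [m, hfp t, periodicSolution_periodic hp t]
  have hNm (t : ℝ) : HasDerivAt (fun t => N (m t)) ((1 / w) • N (periodMean g - c)) t := by
    refine (N.hasFDerivAt.comp_hasDerivAt t (hm t)).congr_deriv ?_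
    rw [map_smul, map_sub N (periodMean g - c), hN, sub_zero]
  have hNc := (eq_of_hasDerivAt_const_of_periodic hNm fun t => by simp only [hmp t]).2
  obtain ⟨h0, hmc⟩ := eq_of_hasDerivAt_const_of_periodic (h := m)
    (v := (1 / w) • (periodMean g - c - N (m 0))) (fun t => by simpa only [hNc t] using hm t) hmp
  refine ⟨m 0, ?_, fun t => ?_⟩
  · have := (smul_eq_zero.1 h0).resolve_left (one_div_ne_zero hw)
    rw [sub_sub, sub_eq_zero] at this
    rw [this]
    abel
  · rw [← hmc t]
    simp only [m]
    abel

end LinearEquation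

end PeriodicFlow

namespace PeriodicFlow

variable {E : Type u} [NormedAddCommGroup E] [NormedSpace ℝ E]
  {M : Type*} [TopologicalSpace M] [ChartedSpace E M]

section Period

variable {X : VField E M} {T : M → ℝ}

theorem CompleteVField.hasMFDerivAt_flow_comp (hc : CompleteVField X) {φ : ℝ → ℝ} {a s : ℝ}
    (hφ : HasDerivAt φ a s) (x : M) :
    HasMFDerivAt 𝓘(ℝ, ℝ) 𝓘(ℝ, E) (fun s => flow X (φ s) x) s
      ((1 : ℝ →L[ℝ] ℝ).smulRight (a • fieldAt X (flow X (φ s) x))) := by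
  refine (HasMFDerivAt.comp s (hc.isMIntegralCurve_flow x (φ s))
    hφ.hasFDerivAt.hasMFDerivAt).congr_mfderiv (ContinuousLinearMap.ext fun (r : ℝ) => ?_)
  exact mul_smul r a (fieldAt X (flow X (φ s) x))

/-- A period function of a flow is constant along the flow, since its derivative vanishes:
differentiate `flow X (s + T (flow X s x)) x = flow X s x`. -/
theorem CompleteVField.covAt_differential_period_eq_zero (hc : CompleteVField X)
    (hT : MDifferentiable 𝓘(ℝ, E) 𝓘(ℝ, ℝ) T)
    (hflow : ∀ s x, flow X (s + T (flow X s x)) x = flow X s x) (x : M) :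
    covAt (differential T) x (fieldAt X x) = 0 := by
  have hτ := hc.hasDerivAt_comp_flow (t := 0) (x := x) (hT _)
  have h1 := hc.hasMFDerivAt_flow_comp ((hasDerivAt_id (0 : ℝ)).add hτ) x
  have h2 : (fun s => flow X ((id + fun s => T (flow X s x) : ℝ → ℝ) s) x) = fun s => flow X s x :=
    funext fun s => hflow s x
  rw [h2] at h1
  have h3 := congrArg (fun L : ℝ →L[ℝ] E => L 1)
    (hasMFDerivAt_unique h1 (hc.isMIntegralCurve_flow x 0))
  have h4 : (1 : ℝ) • ((1 + covAt (differential T) (flow X 0 x) (fieldAt X (flow X 0 x))) •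
      fieldAt X (flow X (0 + T (flow X 0 x)) x)) = (1 : ℝ) • fieldAt X (flow X 0 x) := h3
  rw [hflow, one_smul, one_smul, hc.flow_zero, add_smul, one_smul, add_eq_left, smul_eq_zero] at h4
  rcases h4 with h | h
  · exact h
  · rw [h, map_zero]

theorem frequency_pos {α : Type*} {T : α → ℝ} (hTpos : ∀ m, 0 < T m) (x : α) :
    0 < frequency T x :=
  div_pos Real.two_pi_pos (hTpos x)

theorem contMDiff_frequency (hT : ContMDiff 𝓘(ℝ, E) 𝓘(ℝ, ℝ) ∞ T) (hTpos : ∀ m, 0 < T m) :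
    ContMDiff 𝓘(ℝ, E) 𝓘(ℝ, ℝ) ∞ (frequency T) :=
  contMDiff_const.div₀ hT fun x => (hTpos x).ne'

theorem contMDiff_one_div {f : M → ℝ} (hf : ContMDiff 𝓘(ℝ, E) 𝓘(ℝ, ℝ) ∞ f)
    (hne : ∀ m, f m ≠ 0) : ContMDiff 𝓘(ℝ, E) 𝓘(ℝ, ℝ) ∞ fun x => 1 / f x :=
  contMDiff_const.div₀ hf hne

theorem isMIntegralCurve_circleGenerator (hc : CompleteVField X)
    (hinv : ∀ t x, T (flow X t x) = T x) (x : M) :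
    IsMIntegralCurve (I := 𝓘(ℝ, E)) (fun t => flow X (t * (1 / frequency T x)) x)
      (circleGenerator X T) := by
  intro t
  have h := (hc.isMIntegralCurve_flow x).comp_mul (1 / frequency T x) t
  have h2 (y : M) (hy : T y = T x) : ((1 / frequency T x) • X) y = PeriodicFlow.circleGenerator X T y := by
    simp [PeriodicFlow.circleGenerator, frequency, hy]
  exact h.congr_mfderiv (congrArg _ (h2 _ (hinv _ _)))

theorem CompleteVField.circleGenerator (hc : CompleteVField X)
    (hinv : ∀ t x, T (flow X t x) = T x) : CompleteVField (circleGenerator X T) :=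
  fun x => ⟨_, by simp [hc.flow_zero], isMIntegralCurve_circleGenerator hc hinv x⟩

theorem fieldAt_eq_smul_circleGenerator (hTpos : ∀ m, 0 < T m) (x : M) :
    fieldAt X x = frequency T x • fieldAt (PeriodicFlow.circleGenerator X T) x := by
  have h : fieldAt (PeriodicFlow.circleGenerator X T) x = (1 / frequency T x) • fieldAt X x := rfl
  rw [h, smul_smul, mul_one_div_cancel (frequency_pos hTpos x).ne', one_smul]

variable [IsManifold 𝓘(ℝ, E) ∞ M]

theorem SmoothVField.circleGenerator (hX : SmoothVField X) (hT : ContMDiff 𝓘(ℝ, E) 𝓘(ℝ, ℝ) ∞ T)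
    (hTpos : ∀ m, 0 < T m) : SmoothVField (circleGenerator X T) :=
  ContMDiff.smul_section (contMDiff_one_div (contMDiff_frequency hT hTpos)
    fun x => (frequency_pos hTpos x).ne') hX

variable [T2Space M] [FiniteDimensional ℝ E]

theorem SmoothVField.period_flow (hX : SmoothVField X) (hc : CompleteVField X)
    (hT : MDifferentiable 𝓘(ℝ, E) 𝓘(ℝ, ℝ) T)
    (hper : ∀ (m : M) (t : ℝ), flow X (t + T m) m = flow X t m) (t : ℝ) (x : M) :
    T (flow X t x) = T x := by
  have hflow (s : ℝ) (x : M) : flow X (s + T (flow X s x)) x = flow X s x := by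
    rw [add_comm, hX.flow_add hc, ← zero_add (T _), hper, hc.flow_zero]
  have hd (s : ℝ) : HasDerivAt (fun s => T (flow X s x)) 0 s := by
    have h := hc.hasDerivAt_comp_flow (t := s) (x := x) (hT _)
    rwa [hc.covAt_differential_period_eq_zero hT hflow] at h
  have h := is_const_of_deriv_eq_zero (fun s => (hd s).differentiableAt)
    (fun s => (hd s).deriv) t 0
  rwa [hc.flow_zero] at h

theorem SmoothVField.flow_circleGenerator (hX : SmoothVField X) (hc : CompleteVField X)
    (hT : ContMDiff 𝓘(ℝ, E) 𝓘(ℝ, ℝ) ∞ T) (hTpos : ∀ m, 0 < T m)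
    (hinv : ∀ t x, T (flow X t x) = T x) (t : ℝ) (x : M) :
    flow (PeriodicFlow.circleGenerator X T) t x = flow X (t * (1 / frequency T x)) x := by
  have h := (hX.circleGenerator hT hTpos).flow_eq (hc.circleGenerator hinv)
    (isMIntegralCurve_circleGenerator hc hinv x) t
  simpa [hc.flow_zero] using h

end Period

section LieDerivative

theorem hasDerivAt_compContinuousLinearMap_id_add {k : ℕ} {f : ℝ → E [⋀^Fin k]→L[ℝ] ℝ}
    {f' : E [⋀^Fin k]→L[ℝ] ℝ} {a : ℝ} (hf : HasDerivAt f f' 0) (N : E →L[ℝ] E) :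
    HasDerivAt (fun t : ℝ => (f (a * t)).compContinuousLinearMap (ContinuousLinearMap.id ℝ E + t • N))
      (a • f' + ContinuousAlternatingMap.derivationExt N (f 0)) 0 := by
  have h1 : HasDerivAt (fun t => f (a * t)) (a • f') 0 := by
    have h0 : HasDerivAt f f' (a * 0) := by rwa [mul_zero]
    have := h0.scomp (0 : ℝ) ((hasDerivAt_id (0 : ℝ)).const_mul a)
    rwa [mul_one] at this
  have h2 : HasDerivAt (fun t : ℝ => ContinuousLinearMap.id ℝ E + t • N) N 0 := by
    have := ((hasDerivAt_id (0 : ℝ)).smul_const N).const_add (ContinuousLinearMap.id ℝ E)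
    rwa [one_smul] at this
  have h3 := (h1.hasFDerivAt.continuousAlternatingMapCompContinuousLinearMap
    h2.hasFDerivAt).hasDerivAt
  refine h3.congr_deriv ?_
  simp [ContinuousAlternatingMap.derivationExt_eq]
  rfl

variable [IsManifold 𝓘(ℝ, E) ∞ M] [T2Space M] [FiniteDimensional ℝ E]
  {X Y : VField E M} {w : M → ℝ} {k : ℕ}

/-- The derivative of the flow of `w Y`, for a function `w` that is constant along the flow
of `Y`. -/
theorem SmoothVField.tderiv_flow_of_flow_eq (hY : SmoothVField Y) (hc : CompleteVField Y)
    (hw : MDifferentiable 𝓘(ℝ, E) 𝓘(ℝ, ℝ) w) (hXY : ∀ t x, flow X t x = flow Y (w x * t) x)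
    (t : ℝ) (x : M) :
    tderiv (flow X t) x = tderiv (E := E) (flow Y (w x * t)) x ∘L
      (ContinuousLinearMap.id ℝ E + t • (covAt (differential w) x).smulRight (fieldAt Y x)) := by
  have hΦ : MDifferentiableAt (𝓘(ℝ, ℝ).prod 𝓘(ℝ, E)) 𝓘(ℝ, E) (fun p : ℝ × M => flow Y p.1 p.2)
      (w x * t, x) := (hY.contMDiff_flow hc _).mdifferentiableAt (by simp)
  have hwt : HasMFDerivAt 𝓘(ℝ, E) 𝓘(ℝ, ℝ) (fun y => w y * t) x
      (t • covAt (E := E) (differential w) x) :=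
    (HasMFDerivAt.comp x ((hasDerivAt_id (w x)).mul_const t).hasFDerivAt.hasMFDerivAt
      (hw x).hasMFDerivAt).congr_mfderiv (ContinuousLinearMap.ext fun v => by
        change covAt (E := E) (differential w) x v • (1 * t) =
          t • covAt (E := E) (differential w) x v
        rw [one_mul, smul_eq_mul, smul_eq_mul, mul_comm])
  have hcomp := HasMFDerivAt.comp x (f := fun y => (w y * t, id y)) hΦ.hasMFDerivAt
    (hwt.prodMk (hasMFDerivAt_id (I := 𝓘(ℝ, E)) x))
  have hfun : flow X t = (fun p : ℝ × M => flow Y p.1 p.2) ∘ fun y => (w y * t, id y) :=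
    funext fun y => hXY t y
  rw [hfun]
  refine hcomp.mfderiv.trans (ContinuousLinearMap.ext fun (v : E) => ?_)
  refine (mfderiv_prod_eq_add_apply hΦ).trans ?_
  have h1 := (show HasMFDerivAt 𝓘(ℝ, ℝ) 𝓘(ℝ, E) (fun s => flow Y s x) (w x * t) _ from
    hc.isMIntegralCurve_flow x (w x * t)).mfderiv
  rw [h1]
  change (t • covAt (E := E) (differential w) x v) • fieldAt Y (flow Y (w x * t) x) +
      tderiv (E := E) (flow Y (w x * t)) x v =
    tderiv (E := E) (flow Y (w x * t)) x (v + t • (covAt (E := E) (differential w) x v • fieldAt Y x))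
  rw [map_add, map_smul, map_smul, hY.tderiv_flow_fieldAt hc, smul_smul, smul_eq_mul, add_comm]

theorem SmoothForm.hasDerivAt_pullback_flow (hY : SmoothVField Y) (hc : CompleteVField Y)
    (hw : MDifferentiable 𝓘(ℝ, E) 𝓘(ℝ, ℝ) w) (hXY : ∀ t x, flow X t x = flow Y (w x * t) x)
    {θ : DForm E M k} (hθ : SmoothForm θ) (x : M) :
    HasDerivAt (fun t => formAt (pullback (flow X t) θ) x)
      (w x • deriv (fun t => formAt (pullback (flow Y t) θ) x) 0 +
        ContinuousAlternatingMap.derivationExt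
          ((covAt (differential w) x).smulRight (fieldAt Y x)) (formAt θ x)) 0 := by
  have hd : HasDerivAt (fun t => formAt (pullback (flow Y t) θ) x)
      (deriv (fun t => formAt (pullback (flow Y t) θ) x) 0) 0 :=
    ((hθ.contDiff_formAt_pullback_flow hY hc x).differentiable (by simp) 0).hasDerivAt
  have h := hasDerivAt_compContinuousLinearMap_id_add (a := w x) hd
    ((covAt (differential w) x).smulRight (fieldAt Y x))
  rw [hc.pullback_flow_zero] at h
  refine h.congr_of_eventuallyEq (Filter.Eventually.of_forall fun t => ?_)
  beta_reduce
  rw [formAt_pullback, formAt_pullback, hY.tderiv_flow_of_flow_eq hc hw hXY, hXY,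
    compContinuousLinearMap_comp]

/-- The Lie derivative along `X = w Y`, where `w` is constant along the flow of `Y`, as a
differential equation along the orbits of `Y`. -/
theorem SmoothForm.hasLieDerivative_iff (hY : SmoothVField Y) (hc : CompleteVField Y)
    (hw : MDifferentiable 𝓘(ℝ, E) 𝓘(ℝ, ℝ) w) (hw0 : ∀ x, w x ≠ 0)
    (hinv : ∀ t x, w (flow Y t x) = w x) (hXY : ∀ t x, flow X t x = flow Y (w x * t) x)
    {θ ζ : DForm E M k} (hθ : SmoothForm θ) :
    HasLieDerivative X θ ζ ↔ ∀ x t, HasDerivAt (fun t => formAt (pullback (flow Y t) θ) x)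
      ((1 / w x) • (formAt (pullback (flow Y t) ζ) x - ContinuousAlternatingMap.derivationExt
          ((covAt (differential w) x).smulRight (fieldAt Y x))
            (formAt (pullback (flow Y t) θ) x))) t := by
  have hd (x : M) (t : ℝ) : HasDerivAt (fun t => formAt (pullback (flow Y t) θ) x)
      (deriv (fun t => formAt (pullback (flow Y t) θ) x) t) t :=
    ((hθ.contDiff_formAt_pullback_flow hY hc x).differentiable (by simp) t).hasDerivAt
  have h0 (x : M) := hθ.hasDerivAt_pullback_flow hY hc hw hXY x
  constructor
  · intro h x t
    have h1 (y : M) : HasDerivAt (fun t => formAt (pullback (flow Y t) θ) y)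
        ((1 / w y) • (formAt ζ y - ContinuousAlternatingMap.derivationExt
          ((covAt (differential w) y).smulRight (fieldAt Y y)) (formAt θ y))) 0 := by
      have hy : HasDerivAt (fun t => formAt (pullback (flow X t) θ) y) (formAt ζ y) 0 := h y
      rw [hy.unique (h0 y), add_sub_cancel_right, smul_smul, one_div_mul_cancel (hw0 y), one_smul]
      exact hd y 0
    have h2 := (ContinuousAlternatingMap.compContinuousLinearMapCLM (tderiv (flow Y t) x) :
      (E [⋀^Fin k]→L[ℝ] ℝ) →L[ℝ] _).hasFDerivAt.comp_hasDerivAt (0 : ℝ) (h1 (flow Y t x))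
    have h3 : HasDerivAt (fun s => formAt (pullback (flow Y s) θ) x)
        ((ContinuousAlternatingMap.compContinuousLinearMapCLM (tderiv (flow Y t) x) :
          (E [⋀^Fin k]→L[ℝ] ℝ) →L[ℝ] _) ((1 / w (flow Y t x)) • (formAt ζ (flow Y t x) -
            ContinuousAlternatingMap.derivationExt ((covAt (differential w) (flow Y t x)).smulRight
              (fieldAt Y (flow Y t x))) (formAt θ (flow Y t x))))) (0 + t) := by
      rw [← sub_self t] at h2
      have h4 := HasDerivAt.comp_sub_const t t h2
      rw [zero_add]
      refine h4.congr_of_eventuallyEq (Filter.Eventually.of_forall fun s => ?_)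
      have h5 := hY.pullback_pullback_flow hc t (s - t) θ
      rw [sub_add_cancel] at h5
      beta_reduce
      rw [← h5]
      rfl
    rw [zero_add] at h3
    refine h3.congr_deriv ?_
    rw [map_smul, map_sub, hinv]
    congr 2
    refine ContinuousAlternatingMap.derivationExt_compContinuousLinearMap ?_ _
    rw [← hY.covAt_differential_comp_tderiv_flow hc hw hinv t x]
    ext v
    simp [hY.tderiv_flow_fieldAt hc]
  · intro h x
    have h1 := h x 0
    rw [hc.pullback_flow_zero, hc.pullback_flow_zero] at h1
    refine HasDerivAt.congr_deriv (f := fun t => formAt (pullback (flow X t) θ) x) (h0 x) ?_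
    change _ = formAt ζ x
    rw [h1.deriv, smul_smul, mul_one_div_cancel (hw0 x), one_smul, sub_add_cancel]

end LieDerivative

end PeriodicFlow

namespace PeriodicFlow

variable {E : Type u} [NormedAddCommGroup E] [NormedSpace ℝ E]
  {M : Type*} [TopologicalSpace M] [ChartedSpace E M] [IsManifold 𝓘(ℝ, E) ∞ M] [T2Space M]
  [FiniteDimensional ℝ E] {X Y : VField E M} {w : M → ℝ} {k : ℕ}

theorem SmoothVField.formAt_pullback_flow_opS (hY : SmoothVField Y) (hc : CompleteVField Y)
    {θ : DForm E M k} (hθ : SmoothForm θ) (s : ℝ) (x : M) :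
    formAt (pullback (flow Y s) (opS Y θ)) x =
      periodPrimitive (fun t => formAt (pullback (flow Y t) θ) x) s := by
  rw [opS, formAt_pullback_smul, hY.formAt_pullback_flow_flowIntegral hc (by fun_prop) hθ]
  rfl

/-- The solutions of the homological equation `ℒ_X θ = η - ηbar`, where `X = w Y` and `Y` generates
a circle action. -/
theorem hasLieDerivative_and_invariantForm_iff (hY : SmoothVField Y) (hc : CompleteVField Y)
    (hw : ContMDiff 𝓘(ℝ, E) 𝓘(ℝ, ℝ) ∞ w) (hw0 : ∀ x, w x ≠ 0)
    (hinv : ∀ t x, w (flow Y t x) = w x) (hXY : ∀ t x, flow X t x = flow Y (w x * t) x)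
    (hper : ∀ t x, flow Y (t + 2 * Real.pi) x = flow Y t x) {η θ ηbar : DForm E M k}
    (hη : SmoothForm η) (hθ : SmoothForm θ) :
    (HasLieDerivative X θ (η - ηbar) ∧ InvariantForm Y ηbar) ↔
      ∃ μ : DForm E M k, InvariantForm Y μ ∧
        ηbar = average Y η - covWedge (differential w) (interiorProd Y μ) ∧
        θ = fun x => (1 / w x) • opS Y η x - (1 / w x ^ 2) •
          covWedge (differential w) (interiorProd Y (opS Y (opS Y η))) x + μ x := by
  have hwd : MDifferentiable 𝓘(ℝ, E) 𝓘(ℝ, ℝ) w := hw.mdifferentiable (by simp)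
  let N (x : M) : (E [⋀^Fin k]→L[ℝ] ℝ) →L[ℝ] (E [⋀^Fin k]→L[ℝ] ℝ) :=
    ContinuousAlternatingMap.derivationExt ((covAt (differential w) x).smulRight (fieldAt Y x))
  have hN (x : M) (β : E [⋀^Fin k]→L[ℝ] ℝ) : N x (N x β) = 0 :=
    ContinuousAlternatingMap.derivationExt_smulRight_sq
      (hc.covAt_differential_fieldAt hwd hinv x) β
  let F (ξ : DForm E M k) (x : M) (t : ℝ) : E [⋀^Fin k]→L[ℝ] ℝ := formAt (pullback (flow Y t) ξ) x
  have hFp (ξ : DForm E M k) (x : M) : Function.Periodic (F ξ x) (2 * Real.pi) := fun t => by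
    have h : flow Y (t + 2 * Real.pi) = flow Y t := funext (hper t)
    simp only [F, h]
  have hFc {ξ : DForm E M k} (hξ : SmoothForm ξ) (x : M) : Continuous (F ξ x) :=
    (hξ.contDiff_formAt_pullback_flow hY hc x).continuous
  have hF0 (ξ : DForm E M k) (x : M) : F ξ x 0 = formAt ξ x := by
    simp only [F, hc.pullback_flow_zero]
  have hFN (ξ : DForm E M k) (x : M) (t : ℝ) :
      F (covWedge (differential w) (interiorProd Y ξ)) x t = N x (F ξ x t) :=
    hY.formAt_pullback_flow_derivationExt hc hwd hinv ξ t x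
  have hFS {ξ : DForm E M k} (hξ : SmoothForm ξ) (x : M) :
      F (opS Y ξ) x = periodPrimitive (F ξ x) :=
    funext fun t => hY.formAt_pullback_flow_opS hc hξ t x
  let Ψ : DForm E M k := fun x => (1 / w x) • opS Y η x - (1 / w x ^ 2) •
    covWedge (differential w) (interiorProd Y (opS Y (opS Y η))) x
  have hΨ (x : M) (t : ℝ) : F Ψ x t = periodicSolution (w x) (N x) (F η x) t := by
    change (1 / w (flow Y t x)) • F (opS Y η) x t - (1 / w (flow Y t x) ^ 2) •
      F (covWedge (differential w) (interiorProd Y (opS Y (opS Y η)))) x t = _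
    rw [hinv, hFN, hFS (hη.opS hY hc), hFS hη]
    rfl
  have hFavg (x : M) (t : ℝ) : F (average Y η) x t = periodMean (F η x) := by
    change (1 / (2 * Real.pi)) • formAt (pullback (flow Y t) (flowIntegral Y (fun _ => 1) η)) x = _
    rw [hY.formAt_pullback_flow_flowIntegral hc continuous_const hη]
    simp only [one_smul]
    have h := integral_comp_add_eq_periodMean (hFp η x) t
    simp only [F] at h
    rw [h, smul_smul, one_div_mul_cancel Real.two_pi_pos.ne', one_smul]
  rw [hθ.hasLieDerivative_iff hY hc hwd hw0 hinv hXY]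
  constructor
  · rintro ⟨h, hbar⟩
    have hode (x : M) : ∃ m, formAt ηbar x = periodMean (F η x) - N x m ∧
        ∀ t, F θ x t = periodicSolution (w x) (N x) (F η x) t + m := by
      refine exists_eq_periodicSolution_add (hw0 x) (hN x) (hFc hη x) (hFp η x) (hFp θ x)
        fun t => ?_
      have h1 : F (η - ηbar) x t = F η x t - formAt ηbar x := by
        have h2 : F ηbar x t = formAt ηbar x := by simp only [F, hbar t]
        rw [← h2]
        rfl
      rw [← h1]
      exact h x t
    choose m hm hθm using hode
    have hμ (x : M) (t : ℝ) : F (θ - Ψ) x t = m x := by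
      change F θ x t - F Ψ x t = m x
      rw [hθm, hΨ, add_sub_cancel_left]
    have hμ0 (x : M) : formAt (θ - Ψ) x = m x := by rw [← hF0, hμ]
    refine ⟨θ - Ψ, fun t => DForm.ext_formAt fun x => (hμ x t).trans (hμ0 x).symm, ?_,
      funext fun x => (add_sub_cancel _ _).symm⟩
    refine DForm.ext_formAt fun x => ?_
    rw [hm, ← hFavg x 0, ← hμ x 0, ← hFN, hF0, hF0]
    rfl
  · rintro ⟨μ, hμ, rfl, rfl⟩
    have hFμ (x : M) (t : ℝ) : F μ x t = formAt μ x := by simp only [F, hμ t]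
    have hFbar (x : M) (t : ℝ) :
        F (average Y η - covWedge (differential w) (interiorProd Y μ)) x t =
          periodMean (F η x) - N x (formAt μ x) := by
      rw [← hFμ x t, ← hFN, ← hFavg x t]
      rfl
    refine ⟨fun x t => ?_, fun t => DForm.ext_formAt fun x => ?_⟩
    · have h1 (t : ℝ) : F (Ψ + μ) x t = periodicSolution (w x) (N x) (F η x) t + formAt μ x := by
        rw [← hΨ, ← hFμ x t]
        rfl
      have h2 := (hasDerivAt_periodicSolution (hw0 x) (hN x) (hFc hη x) (hFp η x) t).add_const
        (formAt μ x)
      have h3 : HasDerivAt (F (Ψ + μ) x) ((1 / w x) • (F η x t -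
          F (average Y η - covWedge (differential w) (interiorProd Y μ)) x t -
            N x (F (Ψ + μ) x t))) t := by
        refine (h2.congr_deriv ?_).congr_of_eventuallyEq (Filter.Eventually.of_forall h1)
        rw [hFbar, h1, map_add]
        congr 1
        abel
      exact h3
    · exact (hFbar x t).trans ((hFbar x 0).symm.trans (hF0 _ x))

end PeriodicFlow

theorem theorem3p4 {E : Type*} [NormedAddCommGroup E] [NormedSpace ℝ E] [FiniteDimensional ℝ E]
    {M : Type*} [TopologicalSpace M] [T2Space M] [ChartedSpace E M] [IsManifold 𝓘(ℝ, E) ∞ M]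
    (X : VField E M) (hX : SmoothVField X) (hXc : CompleteVField X)
    (T : M → ℝ) (hT : ContMDiff 𝓘(ℝ, E) 𝓘(ℝ, ℝ) ∞ T) (hTpos : ∀ m, 0 < T m)
    (hper : ∀ (m : M) (t : ℝ), flow X (t + T m) m = flow X t m)
    (freq : M → ℝ) (hfreq : freq = frequency T)
    (Υ : VField E M) (hΥ : Υ = circleGenerator X T)
    (k : ℕ) (η : DForm E M k) (hη : SmoothForm η) (θ ηbar : DForm E M k) :
    (SmoothForm θ ∧ SmoothForm ηbar ∧
        HasLieDerivative X θ (η - ηbar) ∧ InvariantForm Υ ηbar) ↔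
      ∃ μ : DForm E M k, SmoothForm μ ∧ InvariantForm Υ μ ∧
        (ηbar = fun x =>
          average Υ η x - (1 / freq x) • covWedge (differential freq) (interiorProd X μ) x) ∧
        (θ = fun x =>
          (1 / freq x) • opS Υ η x
            - (1 / freq x ^ 3) • covWedge (differential freq) (opS Υ (opS Υ (interiorProd X η))) x
            + μ x) := by
  have hpos := frequency_pos hTpos
  have hw := contMDiff_frequency (E := E) hT hTpos
  have hTinv := hX.period_flow hXc (hT.mdifferentiable (by simp)) hper
  have hY := hX.circleGenerator hT hTpos
  have hYc := hXc.circleGenerator hTinv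
  have hYX := hX.flow_circleGenerator hXc hT hTpos hTinv
  have hinv (t : ℝ) (x : M) : frequency T (flow (circleGenerator X T) t x) = frequency T x := by
    rw [hYX, frequency, hTinv, frequency]
  rw [← hΥ] at hY hYc hYX hinv
  rw [← hfreq] at hpos hw hYX hinv
  have hw0 (x : M) : freq x ≠ 0 := (hpos x).ne'
  have hXY (t : ℝ) (x : M) : flow X t x = flow Υ (freq x * t) x := by
    rw [hYX, mul_right_comm, mul_one_div_cancel (hw0 x), one_mul]
  have hYper (t : ℝ) (x : M) : flow Υ (t + 2 * Real.pi) x = flow Υ t x := by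
    have h : 2 * Real.pi * (1 / freq x) = T x := by
      rw [hfreq, frequency]
      field_simp [(hTpos x).ne', Real.pi_ne_zero]
    rw [hYX, hYX, add_mul, h, hper]
  have hXf (x : M) : fieldAt X x = freq x • fieldAt Υ x := by
    rw [hfreq, hΥ]
    exact fieldAt_eq_smul_circleGenerator hTpos x
  have hXinv (t : ℝ) (x : M) :
      tderiv (flow Υ t) x (fieldAt X x) = fieldAt X (flow Υ t x) := by
    rw [hXf, hXf, map_smul, hY.tderiv_flow_fieldAt hYc, hinv]
  have hN (ξ : DForm E M k) (x : M) : formAt (covWedge (differential freq) (interiorProd X ξ)) x =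
      freq x • formAt (covWedge (differential freq) (interiorProd Υ ξ)) x := by
    rw [formAt_covWedge_interiorProd, formAt_covWedge_interiorProd, hXf]
    have h : (covAt (E := E) (differential freq) x).smulRight (freq x • fieldAt Υ x) =
        freq x • (covAt (E := E) (differential freq) x).smulRight (fieldAt Υ x) := by
      ext v
      simp [smul_comm (freq x)]
    rw [h, map_smul]
    rfl
  have hSS := (hη.opS hY hYc).opS hY hYc
  have hswap : opS Υ (opS Υ (interiorProd X η)) = interiorProd X (opS Υ (opS Υ η)) := by
    rw [hY.opS_interiorProd hYc hXinv hη, hY.opS_interiorProd hYc hXinv (hη.opS hY hYc)]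
  have e1 (μ : DForm E M k) : (fun x => average Υ η x -
      (1 / freq x) • covWedge (differential freq) (interiorProd X μ) x) =
      average Υ η - covWedge (differential freq) (interiorProd Υ μ) := by
    refine DForm.ext_formAt fun x => ?_
    change formAt (average Υ η) x - (1 / freq x) •
        formAt (covWedge (differential freq) (interiorProd X μ)) x =
      formAt (average Υ η) x - formAt (covWedge (differential freq) (interiorProd Υ μ)) x
    rw [hN, smul_smul, one_div_mul_cancel (hw0 x), one_smul]
  have e2 (μ : DForm E M k) : (fun x => (1 / freq x) • opS Υ η x -
        (1 / freq x ^ 3) • covWedge (differential freq) (opS Υ (opS Υ (interiorProd X η))) x + μ x) =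
      fun x => (1 / freq x) • opS Υ η x - (1 / freq x ^ 2) •
        covWedge (differential freq) (interiorProd Υ (opS Υ (opS Υ η))) x + μ x := by
    refine DForm.ext_formAt fun x => ?_
    have h : (1 / freq x ^ 3) •
          formAt (covWedge (differential freq) (opS Υ (opS Υ (interiorProd X η)))) x =
        (1 / freq x ^ 2) •
          formAt (covWedge (differential freq) (interiorProd Υ (opS Υ (opS Υ η)))) x := by
      rw [hswap, hN, smul_smul]
      congr 1
      have := hw0 x
      field_simp
    exact congrArg (fun β => (1 / freq x) • formAt (opS Υ η) x - β + formAt μ x) h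
  have hpart : SmoothForm (fun x => (1 / freq x) • opS Υ η x - (1 / freq x ^ 2) •
      covWedge (differential freq) (interiorProd Υ (opS Υ (opS Υ η))) x : DForm E M k) :=
    ((hη.opS hY hYc).smul (contMDiff_one_div hw hw0)).sub
      ((smoothForm_covWedge_interiorProd hw hY hSS).smul
        (contMDiff_one_div (hw.pow 2) fun x => pow_ne_zero 2 (hw0 x)))
  simp only [e1, e2]
  constructor
  · rintro ⟨hθ, -, h⟩
    obtain ⟨μ, hμ, h1, h2⟩ :=
      (hasLieDerivative_and_invariantForm_iff hY hYc hw hw0 hinv hXY hYper hη hθ).1 h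
    refine ⟨μ, ?_, hμ, h1, h2⟩
    have h3 : μ = θ - fun x => (1 / freq x) • opS Υ η x - (1 / freq x ^ 2) •
        covWedge (differential freq) (interiorProd Υ (opS Υ (opS Υ η))) x := by
      rw [h2]
      exact funext fun x => (add_sub_cancel_left _ _).symm
    rw [h3]
    exact hθ.sub hpart
  · rintro ⟨μ, hμs, hμ, h1, h2⟩
    have hθ : SmoothForm θ := by
      rw [h2]
      exact hpart.add hμs
    have hbar : SmoothForm ηbar := by
      rw [h1]
      exact (hη.average hY hYc).sub (smoothForm_covWedge_interiorProd hw hY hμs)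
    exact ⟨hθ, hbar, (hasLieDerivative_and_invariantForm_iff hY hYc hw hw0 hinv hXY hYper hη hθ).2
      ⟨μ, hμ, h1, h2⟩⟩
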